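/- **Setting.** A *supergeometry* $(X,T^*_{X,-})$ is a (Hausdorff, second countable) complex manifold $X$ with a holomorphic vector bundle $T^*_{X,-}$ on it, the odd conormal bundle. Let $\wedge^\bullet T^*_{X,-}$ be the sheaf of supercommutative $\mathbb C$-algebras of holomorphic sections of its exterior algebra, and $\mathcal J^k=\bigoplus_{j\ge k}\wedge^jT^*_{X,-}$. Let $\mathcal G^{(k)}_{T^*_{X,-}}$ be the sheaf of groups of (parity preserving, $\mathbb C$-linear) algebra automorphisms $\alpha$ of $\wedge^\bullet T^*_{X,-}$ with $\alpha(u)-u\in\mathcal J^k$ for all $u$. For $k\ge 2$ the elements of the Čech cohomology set $\check H^1(X,\mathcal G^{(k)}_{T^*_{X,-}})$ are the *$(k-1)$-split supermanifolds* (supermanifolds of splitting type $k-1$) modelled on $(X,T^*_{X,-})$; the *obstruction sheaf* $\mathcal Q^{(k)}_{T^*_{X,-}}=\mathcal G^{(k)}_{T^*_{X,-}}/\mathcal G^{(k+1)}_{T^*_{X,-}}$ is a sheaf of abelian groups; and the *primary obstruction* $\omega(\mathfrak X)$ of a $(k-1)$-split supermanifold $\mathfrak X$ is its image in $H^1(X,\mathcal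 Q^{(k)}_{T^*_{X,-}})$. A (holomorphic) *embedding of supergeometries* $f=(i,f^\sharp):(Y,T^*_{Y,-})\subset(X,T^*_{X,-})$ is a holomorphic closed embedding $i:Y\subset X$ (in particular $\mathcal O_X\to i_*\mathcal O_Y$ is surjective) together with an $\mathcal O_X$-linear surjection $f^\sharp:T^*_{X,-}\to i_*T^*_{Y,-}$. It induces a surjection $\wedge^\bullet T^*_{X,-}\to i_*\wedge^\bullet T^*_{Y,-}$. Let $\mathcal G^{(k)}_{T^*_{Y,-};T^*_{X,-}}\subset \mathcal G^{(k)}_{T^*_{X,-}}$ be the subsheaf of those automorphisms which preserve the kernel of this surjection. An element of it induces an automorphism on $Y$, whence maps of sheaves of groups $u:\mathcal G^{(k)}_{T^*_{Y,-};T^*_{X,-}}\subset\mathcal G^{(k)}_{T^*_{X,-}}$ and $r:\mathcal G^{(k)}_{T^*_{Y,-};T^*_{X,-}}\to i_*\mathcal G^{(k)}_{T^*_{Y,-}}$, and maps $u_*$, $r_*$ from $\check H^1(X,\mathcal G^{(k)}_{T^*_{Y,-};T^*_{X,-}})$ to $\check H^1(X,\mathcal G^{(k)}_{T^*_{X,-}})$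 and to $\check H^1(Y,\mathcal G^{(k)}_{T^*_{Y,-}})$. For $k\ge2$ let $\mathcal Q^{(k)}_{T^*_{Y,-};T^*_{X,-}}=\mathcal G^{(k)}_{T^*_{Y,-};T^*_{X,-}}/\mathcal G^{(k+1)}_{T^*_{Y,-};T^*_{X,-}}$, an abelian subsheaf of $\mathcal Q^{(k)}_{T^*_{X,-}}$, and $$\mathcal R^{(k)}=\mathcal Q^{(k)}_{T^*_{X,-}}\big/\mathcal Q^{(k)}_{T^*_{Y,-};T^*_{X,-}} .$$ A *$(k-1)$-split embedding* over $f$ is a class $\mathcal Z\in\check H^1(X,\mathcal G^{(k)}_{T^*_{Y,-};T^*_{X,-}})$; its primary obstruction $\omega(\mathcal Z)$ is its image in $H^1(X,\mathcal Q^{(k)}_{T^*_{Y,-};T^*_{X,-}})$. For $k',k''\ge k\ge 2$, a $(k'-1)$-split $\mathfrak Y$ modelled on $(Y,T^*_{Y,-})$ and a $(k''-1)$-split $\mathfrak X$ modelled on $(X,T^*_{X,-})$, one says that $\mathcal Z:\mathfrak Y\subset\mathfrak X$ is an *embedding of total splitting type $(k;k',k'')$* if $r_*\mathcal Z$ is the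 image of $\mathfrak Y$ in $\check H^1(Y,\mathcal G^{(k)}_{T^*_{Y,-}})$ and $u_*\mathcal Z$ is the image of $\mathfrak X$ in $\check H^1(X,\mathcal G^{(k)}_{T^*_{X,-}})$. Write $\mathcal F|_Y=i^{-1}\mathcal F$ for the restriction of a sheaf $\mathcal F$ on $X$ to $Y$. The map $r$ induces a surjection $\bar r:\mathcal Q^{(k)}_{T^*_{Y,-};T^*_{X,-}}|_Y\to\mathcal Q^{(k)}_{T^*_{Y,-}}$. Let $\mathcal P^{(k)}=\mathcal Q^{(k)}_{T^*_{X,-}}|_Y/\ker\bar r$ (equivalently, the pushout of $\bar r$ along the inclusion $\mathcal Q^{(k)}_{T^*_{Y,-};T^*_{X,-}}|_Y\subset\mathcal Q^{(k)}_{T^*_{X,-}}|_Y$). There are exact sequences of sheaves of abelian groups $$0\to\mathcal Q^{(k)}_{T^*_{Y,-};T^*_{X,-}}\to\mathcal Q^{(k)}_{T^*_{X,-}}\to\mathcal R^{(k)}\to0\ \text{ on } X,\qquad 0\to\mathcal Q^{(k)}_{T^*_{Y,-}}\to\mathcal P^{(k)}\to\mathcal R^{(k)}|_Y\to0\ \text{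 on } Y,$$ with connecting maps $\delta_1:H^0(X,\mathcal R^{(k)})\to H^1(X,\mathcal Q^{(k)}_{T^*_{Y,-};T^*_{X,-}})$ and $\delta_2:H^0(Y,\mathcal R^{(k)}|_Y)\to H^1(Y,\mathcal Q^{(k)}_{T^*_{Y,-}})$. Let $r_*:H^0(X,\mathcal R^{(k)})\to H^0(Y,\mathcal R^{(k)}|_Y)$ be the restriction. **Theorem.** Let $k\ge2$ and let $\mathcal Z:\mathfrak Y\subset\mathfrak X$ be an embedding of total splitting type $(k;k,k+1)$ over an embedding of supergeometries $f:(Y,T^*_{Y,-})\subset(X,T^*_{X,-})$. Then there is a global section $\varphi\in H^0(X,\mathcal R^{(k)})$ such that $$\delta_1(\varphi)=\omega(\mathcal Z)\qquad\text{and}\qquad\delta_2\big(r_*(\varphi)\big)=\omega(\mathfrak Y).$$ -/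

import Mathlib

open CategoryTheory CategoryTheory.Limits TopologicalSpace Opposite
open scoped Manifold ContDiff Bundle

universe u

noncomputable section

namespace Cech

variable {X : TopCat.{u}}

/-- An open covering of `X` indexed by the points of `X`, the set of index `x` being a neighbourhood
of `x`. Every open covering has a refinement of this form, so that these coverings suffice to
compute Čech cohomology. -/
structure Cover (X : TopCat.{u}) where
  /-- the open sets of the covering -/
  set : X → Opens X
  mem : ∀ x, x ∈ set x

/-- The intersection of two coverings. -/
def Cover.inf (𝒰 𝒱 : Cover X) : Cover X := ⟨fun x => 𝒰.set x ⊓ 𝒱.set x, fun x => ⟨𝒰.mem x, 𝒱.mem x⟩⟩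

variable (G : (Opens X)ᵒᵖ ⥤ GrpCat.{u})

/-- Restriction of sections of a presheaf of groups. -/
def res {U V : Opens X} (h : V ≤ U) : G.obj (op U) →* G.obj (op V) := (G.map (homOfLE h).op).hom

@[simp] theorem res_res {U V W : Opens X} (h : V ≤ U) (h' : W ≤ V) (s : G.obj (op U)) :
    res G h' (res G h s) = res G (h'.trans h) s := by
  unfold res
  rw [← GrpCat.comp_apply, ← G.map_comp]
  rfl

theorem res_self {U : Opens X} (s : G.obj (op U)) : res G (le_refl U) s = s := by
  unfold res
  have : (homOfLE (le_refl U)).op = 𝟙 (op U) := rfl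
  rw [this, G.map_id]
  rfl

variable {G}

theorem app_res {G' : (Opens X)ᵒᵖ ⥤ GrpCat.{u}} (φ : G ⟶ G') {U V : Opens X} (h : V ≤ U)
    (s : G.obj (op U)) : φ.app (op V) (res G h s) = res G' h (φ.app (op U) s) :=
  congrFun (congrArg (fun f => (f.hom : _ → _)) (φ.naturality (homOfLE h).op)) s

variable (G)

/-- Čech `1`-cocycles `g_{xy} ∈ G(U_x ∩ U_y)`, `g_{xy} g_{yz} = g_{xz}`, with values in a presheaf
of (not necessarily abelian) groups. -/
structure Cocycle where
  /-- the covering -/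
  cover : Cover X
  /-- the sections -/
  val : ∀ x y, G.obj (op (cover.set x ⊓ cover.set y))
  mul_eq : ∀ x y z,
    res G (V := cover.set x ⊓ cover.set y ⊓ cover.set z) inf_le_left (val x y) *
      res G (le_inf (inf_le_left.trans inf_le_right) inf_le_right) (val y z) =
    res G (le_inf (inf_le_left.trans inf_le_left) inf_le_right) (val x z)

variable {G}

/-- Two cocycles are cohomologous if on a common refinement `(W_x)` of their coverings they are
related by `g'_{xy} = h_x g_{xy} h_y⁻¹` for some `h_x ∈ G(W_x)`. -/
def Cocycle.Cohomologous (g g' : Cocycle G) : Prop :=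
  ∃ (𝒲 : Cover X) (h : ∀ x, 𝒲.set x ≤ g.cover.set x) (h' : ∀ x, 𝒲.set x ≤ g'.cover.set x)
    (b : ∀ x, G.obj (op (𝒲.set x))), ∀ x y,
      res G (inf_le_inf (h' x) (h' y)) (g'.val x y) =
        res G inf_le_left (b x) * res G (inf_le_inf (h x) (h y)) (g.val x y) *
          (res G inf_le_right (b y))⁻¹

theorem Cocycle.cohomologous_equivalence : Equivalence (Cocycle.Cohomologous (G := G)) where
  refl g := ⟨g.cover, fun _ => le_rfl, fun _ => le_rfl, fun _ => 1, fun x y => by simp⟩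
  symm := by
    rintro g g' ⟨𝒲, h, h', b, e⟩
    refine ⟨𝒲, h', h, fun x => (b x)⁻¹, fun x y => ?_⟩
    rw [e]
    simp [mul_assoc]
  trans := by
    rintro g g' g'' ⟨𝒲, h₁, h₂, b, e⟩ ⟨𝒱, h₃, h₄, c, e'⟩
    refine ⟨𝒲.inf 𝒱, fun x => inf_le_left.trans (h₁ x), fun x => inf_le_right.trans (h₄ x),
      fun x => res G inf_le_right (c x) * res G inf_le_left (b x), fun x y => ?_⟩
    have i₁ : (𝒲.inf 𝒱).set x ⊓ (𝒲.inf 𝒱).set y ≤ 𝒲.set x ⊓ 𝒲.set y :=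
      inf_le_inf inf_le_left inf_le_left
    have i₂ : (𝒲.inf 𝒱).set x ⊓ (𝒲.inf 𝒱).set y ≤ 𝒱.set x ⊓ 𝒱.set y :=
      inf_le_inf inf_le_right inf_le_right
    have E := congrArg (res G i₁) (e x y)
    have E' := congrArg (res G i₂) (e' x y)
    simp only [map_mul, map_inv, res_res] at E E' ⊢
    rw [E', E]
    erw [map_mul, map_mul, res_res, res_res, res_res, res_res]
    rw [mul_inv_rev]
    simp only [mul_assoc]

instance Cocycle.setoid (G : (Opens X)ᵒᵖ ⥤ GrpCat.{u}) : Setoid (Cocycle G) :=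
  ⟨Cocycle.Cohomologous, Cocycle.cohomologous_equivalence⟩

variable (G)

/-- The first Čech cohomology set `Ȟ¹(X, G)` of a presheaf of groups (the colimit over all
coverings). -/
def H1 : Type u := Quotient (Cocycle.setoid G)

variable {G}

/-- The map on cocycles induced by a morphism of presheaves of groups. -/
def Cocycle.map {G' : (Opens X)ᵒᵖ ⥤ GrpCat.{u}} (φ : G ⟶ G') (g : Cocycle G) : Cocycle G' where
  cover := g.cover
  val x y := φ.app _ (g.val x y)
  mul_eq x y z := by
    rw [← app_res, ← app_res, ← app_res, ← map_mul, g.mul_eq]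

/-- The map on `Ȟ¹` induced by a morphism of presheaves of groups. -/
def H1.map {G' : (Opens X)ᵒᵖ ⥤ GrpCat.{u}} (φ : G ⟶ G') : H1 G → H1 G' :=
  Quotient.map (Cocycle.map φ) (by
    rintro g g' ⟨𝒲, h, h', b, e⟩
    refine ⟨𝒲, h, h', fun x => φ.app _ (b x), fun x y => ?_⟩
    have := congrArg (φ.app _) (e x y)
    rw [map_mul, map_mul, map_inv, app_res, app_res, app_res, app_res] at this
    exact this)

/-- Pull back of cocycles along a continuous map `f : Y → X`, given a morphism from `G` to the
direct image of `G'`. -/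
def Cocycle.pull {Y : TopCat.{u}} (f : Y ⟶ X) {G' : (Opens Y)ᵒᵖ ⥤ GrpCat.{u}}
    (φ : G ⟶ (Opens.map f).op ⋙ G') (g : Cocycle G) : Cocycle G' where
  cover := ⟨fun y => (Opens.map f).obj (g.cover.set (f y)), fun y => g.cover.mem (f y)⟩
  val x y := φ.app _ (g.val (f x) (f y))
  mul_eq x y z := by
    have := congrArg (φ.app _) (g.mul_eq (f x) (f y) (f z))
    rw [map_mul, app_res, app_res, app_res] at this
    exact this

/-- The map `Ȟ¹(X, G) → Ȟ¹(Y, G')` induced by a continuous map `f : Y → X` and a morphism from `G`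
to the direct image of `G'`. -/
def H1.pull {Y : TopCat.{u}} (f : Y ⟶ X) {G' : (Opens Y)ᵒᵖ ⥤ GrpCat.{u}}
    (φ : G ⟶ (Opens.map f).op ⋙ G') : H1 G → H1 G' :=
  Quotient.map (Cocycle.pull f φ) (by
    rintro g g' ⟨𝒲, h, h', b, e⟩
    refine ⟨⟨fun y => (Opens.map f).obj (𝒲.set (f y)), fun y => 𝒲.mem (f y)⟩,
      fun y p hp => h (f y) hp, fun y p hp => h' (f y) hp,
      fun y => φ.app _ (b (f y)), fun x y => ?_⟩
    have := congrArg (φ.app _) (e (f x) (f y))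
    rw [map_mul, map_mul, map_inv, app_res, app_res, app_res, app_res] at this
    exact this)

/-- The presheaf of groups underlying a sheaf of abelian groups. -/
abbrev grp (A : TopCat.Sheaf AddCommGrpCat.{u} X) : (Opens X)ᵒᵖ ⥤ GrpCat.{u} :=
  A.presheaf ⋙ AddCommGrpCat.toCommGrp ⋙ forget₂ CommGrpCat GrpCat

/-- The morphism of presheaves of groups underlying a morphism of sheaves of abelian groups. -/
abbrev grpMap {A B : TopCat.Sheaf AddCommGrpCat.{u} X} (φ : A ⟶ B) : grp A ⟶ grp B :=
  Functor.whiskerRight φ.hom (AddCommGrpCat.toCommGrp ⋙ forget₂ CommGrpCat GrpCat)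

/-- Sections of a sheaf of abelian groups, in additive notation. -/
abbrev sec (A : TopCat.Sheaf AddCommGrpCat.{u} X) (U : Opens X) : Type u := A.presheaf.obj (op U)

/-- Restriction of sections of a sheaf of abelian groups. -/
def sres (A : TopCat.Sheaf AddCommGrpCat.{u} X) {U V : Opens X} (h : V ≤ U) : sec A U →+ sec A V :=
  (A.presheaf.map (homOfLE h).op).hom

/-- Action of a morphism of sheaves of abelian groups on sections. -/
def smap {A B : TopCat.Sheaf AddCommGrpCat.{u} X} (φ : A ⟶ B) (U : Opens X) : sec A U →+ sec B U :=
  (φ.hom.app (op U)).hom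

/-- `H⁰(X, A)`. -/
abbrev H0 (A : TopCat.Sheaf AddCommGrpCat.{u} X) : Type u := sec A ⊤

theorem sres_sres (A : TopCat.Sheaf AddCommGrpCat.{u} X) {U V W : Opens X} (h : V ≤ U)
    (h' : W ≤ V) (s : sec A U) : sres A h' (sres A h s) = sres A (h'.trans h) s := by
  unfold sres
  rw [← AddCommGrpCat.comp_apply, ← A.presheaf.map_comp]
  rfl

theorem smap_sres {A B : TopCat.Sheaf AddCommGrpCat.{u} X} (φ : A ⟶ B) {U V : Opens X} (h : V ≤ U)
    (s : sec A U) : smap φ V (sres A h s) = sres B h (smap φ U s) :=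
  congrFun (congrArg (fun f => (f.hom : _ → _)) (φ.hom.naturality (homOfLE h).op)) s

/-- For a short exact sequence `0 → A → B → C → 0` of sheaves of abelian groups, the relation
that `c ∈ H¹(X, A)` is an image of `s ∈ H⁰(X, C)` under the connecting map: there are a covering `(U_x)`,
liftings `b_x ∈ B(U_x)` of `s` and a cocycle `a_{xy} ∈ A(U_x ∩ U_y)` of class `c` such that
`a_{xy}` maps to `b_y - b_x`. -/
def IsConnecting (S : ShortComplex (TopCat.Sheaf AddCommGrpCat.{u} X)) (s : H0 S.X₃)
    (c : H1 (grp S.X₁)) : Prop :=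
  ∃ (a : Cocycle (grp S.X₁)) (b : ∀ x, sec S.X₂ (a.cover.set x)),
    (∀ x, smap S.g _ (b x) = sres S.X₃ le_top s) ∧
    (∀ x y, smap S.f _ (Multiplicative.toAdd (a.val x y)) =
      sres S.X₂ inf_le_right (b y) - sres S.X₂ inf_le_left (b x)) ∧
    c = Quotient.mk _ a

theorem exists_lift {S : ShortComplex (TopCat.Sheaf AddCommGrpCat.{u} X)} (hS : S.ShortExact)
    {U : Opens X} {b : sec S.X₂ U} (hb : smap S.g U b = 0) : ∃ a : sec S.X₁ U, smap S.f U a = b :=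
  TopCat.Sheaf.sections_exact_of_left_exact hS.exact hS.mono_f b hb

theorem smap_injective {S : ShortComplex (TopCat.Sheaf AddCommGrpCat.{u} X)} (hS : S.ShortExact)
    (U : Opens X) : Function.Injective (smap S.f U) := by
  have := hS.mono_f
  have h1 : Mono ((TopCat.Sheaf.forget AddCommGrpCat X).map S.f) := inferInstance
  have h2 : Mono (S.f.hom.app (op U)) := (NatTrans.mono_iff_mono_app _).mp h1 (op U)
  exact (AddCommGrpCat.mono_iff_injective _).mp h2

theorem exists_isConnecting (S : ShortComplex (TopCat.Sheaf AddCommGrpCat.{u} X))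
    (hS : S.ShortExact) (s : H0 S.X₃) : ∃ c, IsConnecting S s c := by
  have hepi : TopCat.Presheaf.IsLocallySurjective S.g.hom :=
    (TopCat.Sheaf.isLocallySurjective_iff_epi S.g).mpr hS.epi_g
  rw [TopCat.Presheaf.isLocallySurjective_iff] at hepi
  have hloc : ∀ x : X, ∃ V : Opens X, x ∈ V ∧ ∃ b : sec S.X₂ V,
      smap S.g V b = sres S.X₃ le_top s := by
    intro x
    obtain ⟨V, hV, ⟨b, hb⟩, hx⟩ := hepi ⊤ s x trivial
    exact ⟨V, hx, b, hb⟩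
  choose V hV b hb using hloc
  have hab : ∀ x y, ∃ a : sec S.X₁ (V x ⊓ V y), smap S.f _ a =
      sres S.X₂ inf_le_right (b y) - sres S.X₂ inf_le_left (b x) := by
    intro x y
    refine exists_lift hS ?_
    rw [map_sub, smap_sres, smap_sres, hb, hb, sres_sres, sres_sres, sub_self]
  choose a ha using hab
  refine ⟨_, ⟨⟨V, hV⟩, fun x y => Multiplicative.ofAdd (a x y), fun x y z => ?_⟩, b, hb, ha, rfl⟩
  change sres S.X₁ _ (a x y) + sres S.X₁ _ (a y z) = sres S.X₁ _ (a x z)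
  refine smap_injective hS _ ?_
  rw [map_add, smap_sres, smap_sres, smap_sres, ha, ha, ha]
  simp only [map_sub, sres_sres]
  abel

theorem connecting_aux {S : ShortComplex (TopCat.Sheaf AddCommGrpCat.{u} X)} (hS : S.ShortExact)
    (U V U' V' : Opens X) (A : sec S.X₁ (U ⊓ V)) (A' : sec S.X₁ (U' ⊓ V')) (t : sec S.X₁ (U ⊓ U'))
    (r : sec S.X₁ (V ⊓ V')) (b : sec S.X₂ U) (c : sec S.X₂ V) (b' : sec S.X₂ U') (c' : sec S.X₂ V')
    (hA : smap S.f _ A = sres S.X₂ inf_le_right c - sres S.X₂ inf_le_left b)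
    (hA' : smap S.f _ A' = sres S.X₂ inf_le_right c' - sres S.X₂ inf_le_left b')
    (ht : smap S.f _ t = sres S.X₂ inf_le_left b - sres S.X₂ inf_le_right b')
    (hr : smap S.f _ r = sres S.X₂ inf_le_left c - sres S.X₂ inf_le_right c') :
    sres S.X₁ (V := U ⊓ U' ⊓ (V ⊓ V')) (inf_le_inf inf_le_right inf_le_right) A' =
      sres S.X₁ inf_le_left t + sres S.X₁ (inf_le_inf inf_le_left inf_le_left) A +
        -sres S.X₁ inf_le_right r := by
  refine smap_injective hS _ ?_
  rw [map_add, map_add, map_neg, smap_sres, smap_sres, smap_sres, smap_sres, ht, hr, hA, hA']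
  simp only [map_sub, sres_sres]
  abel

/-- The connecting map is well defined. -/
theorem IsConnecting.unique {S : ShortComplex (TopCat.Sheaf AddCommGrpCat.{u} X)}
    (hS : S.ShortExact) {s : H0 S.X₃} {c c' : H1 (grp S.X₁)} (hc : IsConnecting S s c)
    (hc' : IsConnecting S s c') : c = c' := by
  obtain ⟨a, b, hb, ha, rfl⟩ := hc
  obtain ⟨a', b', hb', ha', rfl⟩ := hc'
  have ht : ∀ x, ∃ t : sec S.X₁ (a.cover.set x ⊓ a'.cover.set x), smap S.f _ t =
      sres S.X₂ inf_le_left (b x) - sres S.X₂ inf_le_right (b' x) := by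
    intro x
    refine exists_lift hS ?_
    rw [map_sub, smap_sres, smap_sres, hb, hb', sres_sres, sres_sres, sub_self]
  choose t ht using ht
  refine Quotient.sound ⟨a.cover.inf a'.cover, fun _ => inf_le_left, fun _ => inf_le_right,
    fun x => Multiplicative.ofAdd (t x), fun x y => ?_⟩
  exact connecting_aux hS (a.cover.set x) (a.cover.set y) (a'.cover.set x) (a'.cover.set y)
    (Multiplicative.toAdd (a.val x y)) (Multiplicative.toAdd (a'.val x y)) (t x) (t y)
    (b x) (b y) (b' x) (b' y) (ha x y) (ha' x y) (ht x) (ht y)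

/-- The connecting map `δ : H⁰(X, C) → H¹(X, A)` of a short exact sequence `0 → A → B → C → 0` of
sheaves of abelian groups. -/
def delta (S : ShortComplex (TopCat.Sheaf AddCommGrpCat.{u} X)) (hS : S.ShortExact)
    (s : H0 S.X₃) : H1 (grp S.X₁) := (exists_isConnecting S hS s).choose

end Cech

namespace ExteriorFiltration

variable (M : Type u) [AddCommGroup M] [Module ℂ M]

/-- The part `⨁_{j ≥ k} ⋀ʲ M` of the exterior algebra of `M`. -/
def degGE (k : ℕ) : Submodule ℂ (ExteriorAlgebra ℂ M) := ⨆ j ∈ Set.Ici k, ⋀[ℂ]^j M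

/-- The part `⨁_{j < k} ⋀ʲ M` of the exterior algebra of `M`. -/
def degLT (k : ℕ) : Submodule ℂ (ExteriorAlgebra ℂ M) := ⨆ j ∈ Set.Iio k, ⋀[ℂ]^j M

variable {M}

theorem mem_degGE {j k : ℕ} (h : k ≤ j) {a : ExteriorAlgebra ℂ M} (ha : a ∈ ⋀[ℂ]^j M) :
    a ∈ degGE M k :=
  (le_iSup₂_of_le (f := fun j (_ : j ∈ Set.Ici k) => ⋀[ℂ]^j M) j h le_rfl) ha

theorem mem_degLT {j k : ℕ} (h : j < k) {a : ExteriorAlgebra ℂ M} (ha : a ∈ ⋀[ℂ]^j M) :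
    a ∈ degLT M k :=
  (le_iSup₂_of_le (f := fun j (_ : j ∈ Set.Iio k) => ⋀[ℂ]^j M) j h le_rfl) ha

theorem disjoint_deg (k : ℕ) : Disjoint (degLT M k) (degGE M k) := by
  have h : iSupIndep (fun j : ℕ => ⋀[ℂ]^j M) :=
    (DirectSum.Decomposition.isInternal (fun j : ℕ => ⋀[ℂ]^j M)).submodule_iSupIndep
  refine h.disjoint_biSup_biSup ?_
  rw [Set.disjoint_left]
  intro a ha hb
  simp only [Set.mem_Iio, Set.mem_Ici] at ha hb
  omega

theorem degGE_mul {k l : ℕ} {a b : ExteriorAlgebra ℂ M} (ha : a ∈ degGE M k)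
    (hb : b ∈ degGE M l) : a * b ∈ degGE M (k + l) := by
  have : degGE M k * degGE M l ≤ degGE M (k + l) := by
    unfold degGE
    simp only [Submodule.iSup_mul, Submodule.mul_iSup]
    refine iSup₂_le fun i hi => iSup₂_le fun j hj => ?_
    intro x hx
    rw [← pow_add] at hx
    exact mem_degGE (by simp only [Set.mem_Ici] at hi hj; omega) hx
  exact this (Submodule.mul_mem_mul ha hb)

theorem degGE_mono {k l : ℕ} (h : k ≤ l) : degGE M l ≤ degGE M k :=
  iSup₂_le fun _ hj _ hx => mem_degGE (h.trans hj) hx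

theorem degGE_zero : degGE M 0 = ⊤ := by
  have := DirectSum.IsInternal.submodule_iSup_eq_top
    (DirectSum.Decomposition.isInternal (fun j : ℕ => ⋀[ℂ]^j M))
  rw [eq_top_iff, ← this]
  exact iSup_le fun j x hx => mem_degGE (Nat.zero_le j) hx

theorem map_mem_degGE {N : Type u} [AddCommGroup N] [Module ℂ N] (f : M →ₗ[ℂ] N) {k : ℕ}
    {a : ExteriorAlgebra ℂ M} (ha : a ∈ degGE M k) : ExteriorAlgebra.map f a ∈ degGE N k := by
  have : degGE M k ≤ (degGE N k).comap (ExteriorAlgebra.map f).toLinearMap := by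
    refine iSup₂_le fun j hj x hx => ?_
    refine mem_degGE hj ?_
    have h := Submodule.mem_map_of_mem (f := (ExteriorAlgebra.map f).toLinearMap) hx
    rw [Submodule.map_pow] at h
    have h2 : Submodule.map (ExteriorAlgebra.map f).toLinearMap (LinearMap.range (ExteriorAlgebra.ι ℂ))
        ≤ LinearMap.range (ExteriorAlgebra.ι ℂ) := by
      rw [ExteriorAlgebra.ι_range_map_map]
      exact LinearMap.map_le_range
    exact (pow_le_pow_left' h2 j) h
  exact this ha

/-- The grading involution `a ↦ (-1)^|a| a`. -/
abbrev inv : ExteriorAlgebra ℂ M →ₐ[ℂ] ExteriorAlgebra ℂ M :=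
  CliffordAlgebra.involute (Q := (0 : QuadraticForm ℂ M))

theorem inv_inv (a : ExteriorAlgebra ℂ M) : inv (inv a) = a :=
  CliffordAlgebra.involute_involute a

theorem inv_ι (m : M) : inv (ExteriorAlgebra.ι ℂ m) = - ExteriorAlgebra.ι ℂ m :=
  CliffordAlgebra.involute_ι m

theorem map_inv {N : Type u} [AddCommGroup N] [Module ℂ N] (f : M →ₗ[ℂ] N)
    (a : ExteriorAlgebra ℂ M) :
    ExteriorAlgebra.map f (inv a) = inv (ExteriorAlgebra.map f a) := by
  have : (ExteriorAlgebra.map f).comp inv = inv.comp (ExteriorAlgebra.map f) := by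
    ext m
    simp
  exact DFunLike.congr_fun this a

theorem odd_mem_degGE {a : ExteriorAlgebra ℂ M} (h : inv a = -a) : a ∈ degGE M 1 := by
  have key : ∀ b : ExteriorAlgebra ℂ M, b - inv b ∈ degGE M 1 := by
    intro b
    induction b using ExteriorAlgebra.induction with
    | algebraMap r => simp
    | ι m =>
      rw [inv_ι, sub_neg_eq_add]
      have : ExteriorAlgebra.ι ℂ m ∈ degGE M 1 := mem_degGE le_rfl (by simp)
      exact add_mem this this
    | mul x y hx hy =>
      rw [map_mul]
      have e : x * y - inv x * inv y = (x - inv x) * y + inv x * (y - inv y) := by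
        noncomm_ring
      rw [e]
      refine add_mem ?_ ?_
      · simpa using degGE_mul hx (l := 0) (b := y) (by rw [degGE_zero]; trivial)
      · simpa using degGE_mul (k := 0) (a := inv x) (by rw [degGE_zero]; trivial) hy
    | add x y hx hy =>
      rw [map_add, add_sub_add_comm]
      exact add_mem hx hy
  have h3 := key a
  rw [h, sub_neg_eq_add, ← two_smul ℂ a] at h3
  have := (degGE M 1).smul_mem (2⁻¹ : ℂ) h3
  rwa [smul_smul, inv_mul_cancel₀ two_ne_zero, one_smul] at this

end ExteriorFiltration

/-- A supergeometry `(X, T*_{X,-})`: a complex manifold `X` (Hausdorff, second countable, modelled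
on `ℂⁿ`) together with a holomorphic vector bundle of rank `r` on it, the odd conormal bundle
`T*_{X,-}`. -/
structure Supergeometry where
  /-- the underlying space `X` -/
  space : TopCat.{u}
  /-- the dimension of `X` -/
  dim : ℕ
  /-- the rank of the odd conormal bundle -/
  rank : ℕ
  [charted : ChartedSpace (EuclideanSpace ℂ (Fin dim)) space]
  [manifold : IsManifold 𝓘(ℂ, EuclideanSpace ℂ (Fin dim)) ω space]
  [t2 : T2Space space]
  [secondCountable : SecondCountableTopology space]
  /-- the fibres of the odd conormal bundle -/
  fiber : space → Type u
  [addCommGroup : ∀ x, AddCommGroup (fiber x)]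
  [module : ∀ x, Module ℂ (fiber x)]
  [fiberTopology : ∀ x, TopologicalSpace (fiber x)]
  [totalTopology : TopologicalSpace (Bundle.TotalSpace (EuclideanSpace ℂ (Fin rank)) fiber)]
  [fiberBundle : FiberBundle (EuclideanSpace ℂ (Fin rank)) fiber]
  [vectorBundle : VectorBundle ℂ (EuclideanSpace ℂ (Fin rank)) fiber]
  [holomorphicBundle : ContMDiffVectorBundle ω (EuclideanSpace ℂ (Fin rank)) fiber
    𝓘(ℂ, EuclideanSpace ℂ (Fin dim))]

attribute [instance] Supergeometry.charted Supergeometry.manifold Supergeometry.t2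
  Supergeometry.secondCountable Supergeometry.addCommGroup Supergeometry.module
  Supergeometry.fiberTopology Supergeometry.totalTopology Supergeometry.fiberBundle
  Supergeometry.vectorBundle Supergeometry.holomorphicBundle

namespace Supergeometry

open ExteriorFiltration

variable (X : Supergeometry.{u})

/-- The model with corners of the complex manifold `X`. -/
abbrev I : ModelWithCorners ℂ (EuclideanSpace ℂ (Fin X.dim)) (EuclideanSpace ℂ (Fin X.dim)) :=
  𝓘(ℂ, EuclideanSpace ℂ (Fin X.dim))

/-- The model fibre of the odd conormal bundle. -/
abbrev F : Type := EuclideanSpace ℂ (Fin X.rank)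

variable {X}

/-- Holomorphic functions on the open set `U`. -/
def IsHolFun {U : Opens X.space} (f : U → ℂ) : Prop := ContMDiff X.I 𝓘(ℂ) ω f

/-- Holomorphic sections of `T*_{X,-}` over the open set `U`. -/
def IsHolSec {U : Opens X.space} (σ : ∀ x : U, X.fiber x) : Prop :=
  ContMDiff X.I (X.I.prod 𝓘(ℂ, X.F)) ω
    (fun x : U => (⟨x, σ x⟩ : Bundle.TotalSpace X.F X.fiber))

theorem IsHolFun.res {U W : Opens X.space} (h : W ≤ U) {f : U → ℂ} (hf : IsHolFun f) :
    IsHolFun (fun x : W => f ⟨x, h x.2⟩) :=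
  ContMDiff.comp hf (contMDiff_inclusion h)

theorem IsHolSec.res {U W : Opens X.space} (h : W ≤ U) {σ : ∀ x : U, X.fiber x}
    (hσ : IsHolSec σ) : IsHolSec (fun x : W => σ ⟨x, h x.2⟩) :=
  ContMDiff.comp hσ (contMDiff_inclusion h)

/-- Families of elements of the exterior algebras of the fibres over `U`, not necessarily
holomorphic. -/
abbrev Families (U : Opens X.space) : Type u := ∀ x : U, ExteriorAlgebra ℂ (X.fiber x)

/-- Restriction of families. -/
def famRes {U W : Opens X.space} (h : W ≤ U) : Families U →ₐ[ℂ] Families W where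
  toFun s x := s ⟨x, h x.2⟩
  map_one' := rfl
  map_mul' _ _ := rfl
  map_zero' := rfl
  map_add' _ _ := rfl
  commutes' _ := rfl

/-- The holomorphic functions and the holomorphic sections of `T*_{X,-}` over `U`, seen as families
of elements of the exterior algebras. -/
def gens (U : Opens X.space) : Set (Families U) :=
  {s | ∃ f : U → ℂ, IsHolFun f ∧ s = fun x => algebraMap ℂ _ (f x)} ∪
  {s | ∃ σ : ∀ x : U, X.fiber x, IsHolSec σ ∧ s = fun x => ExteriorAlgebra.ι ℂ (σ x)}

theorem famRes_gens {U W : Opens X.space} (h : W ≤ U) {s : Families U} (hs : s ∈ gens U) :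
    famRes h s ∈ gens W := by
  rcases hs with ⟨f, hf, rfl⟩ | ⟨σ, hσ, rfl⟩
  · exact Or.inl ⟨_, hf.res h, rfl⟩
  · exact Or.inr ⟨_, hσ.res h, rfl⟩

theorem famRes_adjoin {U W : Opens X.space} (h : W ≤ U) {s : Families U}
    (hs : s ∈ Algebra.adjoin ℂ (gens U)) : famRes h s ∈ Algebra.adjoin ℂ (gens W) := by
  have : Algebra.adjoin ℂ (gens U) ≤ (Algebra.adjoin ℂ (gens W)).comap (famRes h) :=
    Algebra.adjoin_le fun s hs => Algebra.subset_adjoin (famRes_gens h hs)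
  exact this hs

/-- `Γ(U, ⋀^• T*_{X,-})`: the holomorphic sections of the exterior algebra of `T*_{X,-}`, that is
the families which locally are polynomials in holomorphic functions and holomorphic sections of
`T*_{X,-}`. -/
def Λ (U : Opens X.space) : Subalgebra ℂ (Families U) where
  carrier := {s | ∀ x ∈ U, ∃ W : Opens X.space, x ∈ W ∧ ∃ h : W ≤ U,
    famRes h s ∈ Algebra.adjoin ℂ (gens W)}
  mul_mem' {s t} hs ht x hx := by
    obtain ⟨W, hxW, hW, h1⟩ := hs x hx
    obtain ⟨W', hxW', hW', h2⟩ := ht x hx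
    refine ⟨W ⊓ W', ⟨hxW, hxW'⟩, inf_le_left.trans hW, ?_⟩
    rw [map_mul]
    exact mul_mem (famRes_adjoin (inf_le_left : W ⊓ W' ≤ W) h1)
      (famRes_adjoin (inf_le_right : W ⊓ W' ≤ W') h2)
  add_mem' {s t} hs ht x hx := by
    obtain ⟨W, hxW, hW, h1⟩ := hs x hx
    obtain ⟨W', hxW', hW', h2⟩ := ht x hx
    refine ⟨W ⊓ W', ⟨hxW, hxW'⟩, inf_le_left.trans hW, ?_⟩
    rw [map_add]
    exact add_mem (famRes_adjoin (inf_le_left : W ⊓ W' ≤ W) h1)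
      (famRes_adjoin (inf_le_right : W ⊓ W' ≤ W') h2)
  algebraMap_mem' r _ hx := ⟨U, hx, le_rfl, Subalgebra.algebraMap_mem _ r⟩

/-- Restriction of sections of `⋀^• T*_{X,-}`. -/
def res {U W : Opens X.space} (h : W ≤ U) : Λ U →ₐ[ℂ] Λ W :=
  ((famRes h).comp (Λ U).val).codRestrict (Λ W) fun s x hx => by
    obtain ⟨W', hxW, hW, h1⟩ := s.2 x (h hx)
    exact ⟨W' ⊓ W, ⟨hxW, hx⟩, inf_le_right, famRes_adjoin (inf_le_left : W' ⊓ W ≤ W') h1⟩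

@[simp] theorem res_apply {U W : Opens X.space} (h : W ≤ U) (s : Λ U) (x : W) :
    (res h s).1 x = s.1 ⟨x, h x.2⟩ := rfl

@[simp] theorem res_res {U V W : Opens X.space} (h : V ≤ U) (h' : W ≤ V) (s : Λ U) :
    res h' (res h s) = res (h'.trans h) s := rfl

theorem ext_local {U : Opens X.space} {s t : Λ U}
    (h : ∀ x ∈ U, ∃ W : Opens X.space, x ∈ W ∧ ∃ h : W ≤ U, res h s = res h t) : s = t := by
  refine Subtype.ext (funext fun x => ?_)
  obtain ⟨W, hx, hW, e⟩ := h x x.2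
  exact congrFun (congrArg Subtype.val e) ⟨x, hx⟩

/-- The grading involution on families. -/
def famInv (U : Opens X.space) : Families U →ₐ[ℂ] Families U :=
  AlgHom.pi fun x => (inv (M := X.fiber x)).comp (Pi.evalAlgHom ℂ _ x)

/-- The grading (parity) involution `s ↦ (-1)^|s| s` of `⋀^• T*_{X,-}`. -/
def parity (U : Opens X.space) : Λ U →ₐ[ℂ] Λ U :=
  ((famInv U).comp (Λ U).val).codRestrict (Λ U) fun s x hx => by
    obtain ⟨W, hxW, hW, h1⟩ := s.2 x hx
    refine ⟨W, hxW, hW, ?_⟩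
    have : Algebra.adjoin ℂ (gens W) ≤ (Algebra.adjoin ℂ (gens W)).comap (famInv W) := by
      refine Algebra.adjoin_le ?_
      rintro s (⟨f, hf, rfl⟩ | ⟨σ, hσ, rfl⟩)
      · refine Algebra.subset_adjoin (Or.inl ⟨f, hf, ?_⟩)
        funext x
        exact AlgHom.commutes _ _
      · have : famInv W (fun x => ExteriorAlgebra.ι ℂ (σ x))
            = -(fun x => ExteriorAlgebra.ι ℂ (σ x)) := by
          funext x
          exact inv_ι _
        change famInv W _ ∈ Algebra.adjoin ℂ (gens W)
        rw [this]
        exact neg_mem (Algebra.subset_adjoin (Or.inr ⟨σ, hσ, rfl⟩))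
    exact this h1

@[simp] theorem parity_apply {U : Opens X.space} (s : Λ U) (x : U) :
    (parity U s).1 x = inv (s.1 x) := rfl

theorem res_parity {U W : Opens X.space} (h : W ≤ U) (s : Λ U) :
    res h (parity U s) = parity W (res h s) := rfl

/-- `Γ(U, 𝒥^k)`, where `𝒥^k = ⨁_{j ≥ k} ⋀ʲ T*_{X,-}`. -/
def J (k : ℕ) (U : Opens X.space) : Submodule ℂ (Λ U) where
  carrier := {s | ∀ x : U, s.1 x ∈ degGE (X.fiber x) k}
  add_mem' hs ht x := add_mem (hs x) (ht x)
  zero_mem' _ := zero_mem _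
  smul_mem' c _ hs x := (degGE _ k).smul_mem c (hs x)

theorem mem_J {k : ℕ} {U : Opens X.space} {s : Λ U} :
    s ∈ J k U ↔ ∀ x : U, s.1 x ∈ degGE (X.fiber x) k := Iff.rfl

theorem J_mono {k l : ℕ} (h : k ≤ l) (U : Opens X.space) : J l U ≤ J (X := X) k U :=
  fun _ hs x => degGE_mono h (hs x)

theorem J_mul {k l : ℕ} {U : Opens X.space} {s t : Λ U} (hs : s ∈ J k U) (ht : t ∈ J l U) :
    s * t ∈ J (k + l) U := fun x => degGE_mul (hs x) (ht x)

theorem mem_J_zero {U : Opens X.space} (s : Λ U) : s ∈ J 0 U := fun x => by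
  rw [degGE_zero]; trivial

theorem res_J {k : ℕ} {U W : Opens X.space} (h : W ≤ U) {s : Λ U} (hs : s ∈ J k U) :
    res h s ∈ J k W := fun x => hs ⟨x, h x.2⟩

theorem mem_J_local {k : ℕ} {U : Opens X.space} {s : Λ U}
    (h : ∀ x ∈ U, ∃ W : Opens X.space, x ∈ W ∧ ∃ h : W ≤ U, res h s ∈ J k W) : s ∈ J k U := by
  intro x
  obtain ⟨W, hx, hW, e⟩ := h x x.2
  exact e ⟨x, hx⟩

/-- The odd sections. -/
def oddPart (U : Opens X.space) : Submodule ℂ (Λ U) :=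
  LinearMap.ker ((parity U).toLinearMap + LinearMap.id)

theorem mem_oddPart {U : Opens X.space} {s : Λ U} : s ∈ oddPart U ↔ parity U s = -s := by
  simp [oddPart, eq_neg_iff_add_eq_zero]

theorem oddPart_le_J (U : Opens X.space) : oddPart U ≤ J (X := X) 1 U := by
  intro s hs x
  rw [mem_oddPart] at hs
  exact odd_mem_degGE (congrFun (congrArg Subtype.val hs) x)

theorem adjoin_le_Λ {U : Opens X.space} {s : Families U} (h : s ∈ Algebra.adjoin ℂ (gens U)) :
    s ∈ Λ U := fun _ hx => ⟨U, hx, le_rfl, h⟩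

theorem mem_mul_top {A : Type u} [Ring A] [Algebra ℂ A] {P Q : Submodule ℂ A} {a : A}
    (h : a ∈ P * Q) : a ∈ P * (⊤ : Submodule ℂ A) :=
  (show P * Q ≤ P * ⊤ from mul_le_mul_right le_top P) h

/-- Monomials in the generators are homogeneous and products of as many odd sections as their degree
says. -/
theorem monomial_aux {U : Opens X.space} {s : Families U} (hs : s ∈ Submonoid.closure (gens U)) :
    ∃ j : ℕ, (∀ x : U, s x ∈ ⋀[ℂ]^j (X.fiber x)) ∧
      ∃ t : Λ U, t.1 = s ∧ t ∈ oddPart U ^ j * (⊤ : Submodule ℂ (Λ U)) := by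
  induction hs using Submonoid.closure_induction_left with
  | one =>
    refine ⟨0, fun x => ?_, 1, rfl, ?_⟩
    · change (1 : ExteriorAlgebra ℂ (X.fiber x)) ∈
        (LinearMap.range (ExteriorAlgebra.ι ℂ (M := X.fiber x)) ^ 0)
      rw [pow_zero]
      exact Submodule.one_le.mp le_rfl
    rw [pow_zero, one_mul]
    trivial
  | mul_left g hg s hs ih =>
    obtain ⟨j, hj, t, rfl, ht⟩ := ih
    have hgΛ : g ∈ Λ U := adjoin_le_Λ (Algebra.subset_adjoin hg)
    rcases hg with ⟨f, hf, rfl⟩ | ⟨σ, hσ, rfl⟩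
    · refine ⟨j, fun x => ?_, ⟨_, hgΛ⟩ * t, rfl, ?_⟩
      · have := (⋀[ℂ]^j (X.fiber x)).smul_mem (f x) (hj x)
        rwa [Algebra.smul_def] at this
      · have e : (⟨_, hgΛ⟩ : Λ U) * t = t * ⟨_, hgΛ⟩ := by
          refine Subtype.ext (funext fun x => ?_)
          exact Algebra.commutes (f x) (t.1 x)
        rw [e]
        have := Submodule.mul_mem_mul ht (Submodule.mem_top (R := ℂ) (x := (⟨_, hgΛ⟩ : Λ U)))
        rw [mul_assoc] at this
        exact mem_mul_top this
    · refine ⟨j + 1, fun x => ?_, ⟨_, hgΛ⟩ * t, rfl, ?_⟩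
      · change _ ∈ (LinearMap.range (ExteriorAlgebra.ι ℂ (M := X.fiber x)) ^ (j + 1))
        rw [pow_succ']
        exact Submodule.mul_mem_mul (LinearMap.mem_range_self _ _) (hj x)
      · rw [pow_succ', mul_assoc]
        refine Submodule.mul_mem_mul ?_ ht
        rw [mem_oddPart]
        refine Subtype.ext (funext fun x => ?_)
        exact inv_ι _

/-- Sections of `𝒥^m` are locally sums of products of `m` odd sections and one more section. -/
theorem J_local {m : ℕ} {U : Opens X.space} {s : Λ U} (hs : s ∈ J m U) :
    ∀ x ∈ U, ∃ W : Opens X.space, x ∈ W ∧ ∃ h : W ≤ U,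
      res h s ∈ oddPart W ^ m * (⊤ : Submodule ℂ (Λ W)) := by
  intro x hx
  obtain ⟨W, hxW, hW, h1⟩ := s.2 x hx
  refine ⟨W, hxW, hW, ?_⟩
  have key : ∀ w ∈ Algebra.adjoin ℂ (gens W), ∃ u t : Λ W, w = (u + t).1 ∧
      (∀ x : W, u.1 x ∈ degLT (X.fiber x) m) ∧ t ∈ oddPart W ^ m * (⊤ : Submodule ℂ (Λ W)) := by
    intro w hw
    rw [← Subalgebra.mem_toSubmodule, Algebra.adjoin_eq_span] at hw
    induction hw using Submodule.span_induction with
    | mem w hw =>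
      obtain ⟨j, hj, t, rfl, ht⟩ := monomial_aux hw
      by_cases hjm : j < m
      · exact ⟨t, 0, by simp, fun x => mem_degLT hjm (hj x), zero_mem _⟩
      · refine ⟨0, t, by simp, fun x => zero_mem _, ?_⟩
        obtain ⟨i, rfl⟩ := Nat.exists_eq_add_of_le (not_lt.mp hjm)
        rw [pow_add, mul_assoc] at ht
        exact mem_mul_top ht
    | zero => exact ⟨0, 0, by simp, fun x => zero_mem _, zero_mem _⟩
    | add w w' _ _ ih ih' =>
      obtain ⟨u, t, rfl, hu, ht⟩ := ih
      obtain ⟨u', t', rfl, hu', ht'⟩ := ih'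
      exact ⟨u + u', t + t', by push_cast; abel, fun x => add_mem (hu x) (hu' x),
        add_mem ht ht'⟩
    | smul c w _ ih =>
      obtain ⟨u, t, rfl, hu, ht⟩ := ih
      exact ⟨c • u, c • t, by simp, fun x => Submodule.smul_mem _ c (hu x),
        Submodule.smul_mem _ c ht⟩
  obtain ⟨u, t, hut, hu, ht⟩ := key _ h1
  have hres : res hW s = u + t := Subtype.ext hut
  have htJ : t ∈ J m W := by
    have : oddPart W ^ m * (⊤ : Submodule ℂ (Λ W)) ≤ J m W := by
      have hp : ∀ m : ℕ, oddPart W ^ m ≤ J m W := by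
        intro m
        induction m with
        | zero => exact fun s _ => mem_J_zero s
        | succ m ih =>
          rw [pow_succ, Submodule.mul_le]
          exact fun a ha b hb => J_mul (ih ha) (oddPart_le_J W hb)
      rw [Submodule.mul_le]
      exact fun a ha b _ => by simpa using J_mul (hp m ha) (mem_J_zero b)
    exact this ht
  have hu0 : u = 0 := by
    refine Subtype.ext (funext fun x => ?_)
    refine Submodule.disjoint_def.mp (disjoint_deg m) _ (hu x) ?_
    have e : u = res hW s - t := by rw [hres]; abel
    rw [e]
    exact sub_mem (res_J hW hs x) (htJ x)
  rw [hres, hu0, zero_add]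
  exact ht

end Supergeometry

namespace Supergeometry

variable {X : Supergeometry.{u}}

/-- Families of algebra automorphisms `α_W` of `Γ(W, ⋀^• T*_{X,-})`, for `W ⊆ U` open, not
necessarily compatible with restrictions. -/
abbrev PreAut (U : Opens X.space) : Type u := ∀ W : {W : Opens X.space // W ≤ U}, Λ W.1 ≃ₐ[ℂ] Λ W.1

/-- Restriction of families of automorphisms. -/
def PreAut.res {U V : Opens X.space} (h : V ≤ U) : PreAut U →* PreAut V where
  toFun α W := α ⟨W.1, W.2.trans h⟩
  map_one' := rfl
  map_mul' _ _ := rfl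

/-- `𝒜ut ⋀^• T*_{X,-}` over `U`: the automorphisms of the restriction to `U` of the sheaf
`⋀^• T*_{X,-}` of supercommutative `ℂ`-algebras. They are compatible with restrictions and preserve
the parity. -/
def AutSheaf (U : Opens X.space) : Subgroup (PreAut U) where
  carrier := {α | (∀ (W : {W : Opens X.space // W ≤ U}) (W' : Opens X.space) (h : W' ≤ W.1)
      (s : Λ W.1), res h (α W s) = α ⟨W', h.trans W.2⟩ (res h s)) ∧
    ∀ (W : {W : Opens X.space // W ≤ U}) (s : Λ W.1), α W (parity W.1 s) = parity W.1 (α W s)}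
  one_mem' := ⟨fun _ _ _ _ => rfl, fun _ _ => rfl⟩
  mul_mem' {α β} hα hβ := by
    refine ⟨fun W W' h s => ?_, fun W s => ?_⟩
    · change res h (α W (β W s)) = α ⟨W', h.trans W.2⟩ (β ⟨W', h.trans W.2⟩ (res h s))
      rw [hα.1, hβ.1]
    · change α W (β W _) = parity _ (α W (β W s))
      rw [hβ.2, hα.2]
  inv_mem' {α} hα := by
    refine ⟨fun W W' h s => ?_, fun W s => ?_⟩
    · change res h ((α W).symm s) = (α ⟨W', h.trans W.2⟩).symm (res h s)
      rw [AlgEquiv.eq_symm_apply, ← hα.1, AlgEquiv.apply_symm_apply]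
    · change (α W).symm _ = parity _ ((α W).symm s)
      rw [AlgEquiv.symm_apply_eq, hα.2, AlgEquiv.apply_symm_apply]

/-- Green's group `𝒢^{(k)}` over `U`: the automorphisms `α` with `α(u) - u ∈ 𝒥^k` for all `u`. -/
def green (k : ℕ) (U : Opens X.space) : Subgroup (PreAut U) where
  carrier := {α | α ∈ AutSheaf U ∧
    ∀ (W : {W : Opens X.space // W ≤ U}) (s : Λ W.1), α W s - s ∈ J k W.1}
  one_mem' := ⟨one_mem _, fun W s => by
    change s - s ∈ _
    rw [sub_self]; exact zero_mem _⟩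
  mul_mem' {α β} hα hβ := by
    refine ⟨mul_mem hα.1 hβ.1, fun W s => ?_⟩
    change α W (β W s) - s ∈ _
    rw [← sub_add_sub_cancel _ (β W s)]
    exact add_mem (hα.2 W _) (hβ.2 W s)
  inv_mem' {α} hα := by
    refine ⟨inv_mem hα.1, fun W s => ?_⟩
    change (α W).symm s - s ∈ _
    have h := neg_mem (hα.2 W ((α W).symm s))
    rwa [AlgEquiv.apply_symm_apply, neg_sub] at h

theorem green_le_aut (k : ℕ) (U : Opens X.space) : green k U ≤ AutSheaf U := fun _ h => h.1

theorem green_anti {k l : ℕ} (h : k ≤ l) (U : Opens X.space) : green (X := X) l U ≤ green k U :=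
  fun _ hα => ⟨hα.1, fun W s => J_mono h _ (hα.2 W s)⟩

/-- An element of `𝒢^{(k)}`, `k ≥ 2`, induces the identity on `𝒥^m / 𝒥^{m+1}`. -/
theorem green_sub_mem {k : ℕ} (hk : 2 ≤ k) {U : Opens X.space} {α : PreAut U} (hα : α ∈ green k U)
    {m : ℕ} (W : {W : Opens X.space // W ≤ U}) {s : Λ W.1} (hs : s ∈ J m W.1) :
    α W s - s ∈ J (m + 1) W.1 := by
  refine mem_J_local fun x hx => ?_
  obtain ⟨W', hxW, hW, hloc⟩ := J_local hs x hx
  refine ⟨W', hxW, hW, ?_⟩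
  rw [map_sub, hα.1.1 W W' hW]
  generalize res hW s = t at hloc
  set V : {W : Opens X.space // W ≤ U} := ⟨W', hW.trans W.2⟩
  change t ∈ oddPart V.1 ^ m * ⊤ at hloc
  change α V t - t ∈ J (m + 1) V.1
  have hpow : ∀ m : ℕ, ∀ t ∈ oddPart V.1 ^ m, t ∈ J m V.1 ∧ α V t - t ∈ J (m + 1) V.1 := by
    intro m
    induction m with
    | zero => exact fun t _ => ⟨mem_J_zero t, J_mono (by omega) _ (hα.2 V t)⟩
    | succ m ih =>
      intro t ht
      rw [pow_succ] at ht
      induction ht using Submodule.mul_induction_on' with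
      | mem_mul_mem a ha b hb =>
        refine ⟨J_mul (ih a ha).1 (oddPart_le_J _ hb), ?_⟩
        have e : α V (a * b) - a * b = (α V a - a) * b + α V a * (α V b - b) := by
          rw [map_mul, sub_mul, mul_sub]; abel
        rw [e]
        refine add_mem (J_mul (ih a ha).2 (oddPart_le_J _ hb)) ?_
        have h1 : α V a ∈ J m V.1 := by
          have := add_mem (J_mono (Nat.le_succ m) _ (ih a ha).2) (ih a ha).1
          rwa [sub_add_cancel] at this
        exact J_mul (k := m) (l := 2) h1 (J_mono hk _ (hα.2 V b))
      | add a _ b _ ha hb =>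
        refine ⟨add_mem ha.1 hb.1, ?_⟩
        rw [map_add, add_sub_add_comm]
        exact add_mem ha.2 hb.2
  induction hloc using Submodule.mul_induction_on' with
  | mem_mul_mem a ha b hb =>
    have e : α V (a * b) - a * b = (α V a - a) * b + α V a * (α V b - b) := by
      rw [map_mul, sub_mul, mul_sub]; abel
    rw [e]
    have h1 : α V a ∈ J m V.1 := by
      have := add_mem (J_mono (Nat.le_succ m) _ (hpow m a ha).2) (hpow m a ha).1
      rwa [sub_add_cancel] at this
    exact add_mem (by simpa using J_mul (hpow m a ha).2 (mem_J_zero b))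
      (J_mul h1 (J_mono (by omega) _ (hα.2 V b)))
  | add a _ b _ ha hb =>
    rw [map_add, add_sub_add_comm]
    exact add_mem ha hb

/-- Commutators of elements of `𝒢^{(k)}`, `k ≥ 2`, lie in `𝒢^{(k+1)}`. -/
theorem green_commutator {k : ℕ} (hk : 2 ≤ k) {U : Opens X.space} {α β : PreAut U}
    (hα : α ∈ green k U) (hβ : β ∈ green k U) : α * β * α⁻¹ * β⁻¹ ∈ green (k + 1) U := by
  refine ⟨mul_mem (mul_mem (mul_mem hα.1 hβ.1) (inv_mem hα.1)) (inv_mem hβ.1), fun W s => ?_⟩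
  have key : ∀ t : Λ W.1, α W (β W t) - β W (α W t) ∈ J (k + 1) W.1 := by
    intro t
    have h1 := green_sub_mem hk hα W (hβ.2 W t)
    have h2 := green_sub_mem hk hβ W (hα.2 W t)
    rw [map_sub] at h1 h2
    have := sub_mem h1 h2
    convert this using 1
    abel
  have := key ((α W).symm ((β W).symm s))
  simpa using this

/-- A family of subgroups of `𝒜ut ⋀^• T*_{X,-}` which is stable under restrictions: a (pre)sheaf
of groups of automorphisms. -/
structure AutFamily (X : Supergeometry.{u}) where
  /-- the group over `U` -/
  grp : ∀ U : Opens X.space, Subgroup (PreAut U)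
  res_mem : ∀ {U V : Opens X.space} (h : V ≤ U) {α : PreAut U}, α ∈ grp U →
    PreAut.res h α ∈ grp V

/-- The presheaf of groups given by a family of groups of automorphisms. -/
def AutFamily.presheaf (S : AutFamily X) : (Opens X.space)ᵒᵖ ⥤ GrpCat.{u} where
  obj U := GrpCat.of (S.grp U.unop)
  map {U V} h := GrpCat.ofHom
    (((PreAut.res (leOfHom h.unop)).comp (S.grp U.unop).subtype).codRestrict (S.grp V.unop)
      fun α => S.res_mem (leOfHom h.unop) α.2)
  map_id _ := rfl
  map_comp _ _ := rfl

/-- Green's sheaf of groups `𝒢^{(k)}`. -/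
def greenFamily (X : Supergeometry.{u}) (k : ℕ) : AutFamily X where
  grp := green k
  res_mem h _ hα := ⟨⟨fun W => hα.1.1 ⟨W.1, W.2.trans h⟩, fun W => hα.1.2 ⟨W.1, W.2.trans h⟩⟩,
    fun W => hα.2 ⟨W.1, W.2.trans h⟩⟩

/-- The inclusion of presheaves of groups of automorphisms. -/
def AutFamily.incl {S T : AutFamily X} (h : ∀ U, S.grp U ≤ T.grp U) : S.presheaf ⟶ T.presheaf where
  app U := GrpCat.ofHom (X := S.grp U.unop) (Y := T.grp U.unop) (Subgroup.inclusion (h U.unop))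
  naturality _ _ _ := rfl

/-- A pair of families of groups of automorphisms `N ⊆ S` such that the commutators of `S` lie
in `N`. -/
structure AutPair (X : Supergeometry.{u}) where
  S : AutFamily X
  N : AutFamily X
  le : ∀ U, N.grp U ≤ S.grp U
  comm : ∀ {U} {α β : PreAut U}, α ∈ S.grp U → β ∈ S.grp U → α * β * α⁻¹ * β⁻¹ ∈ N.grp U

namespace AutPair

variable (P : AutPair X)

/-- `N` as a subgroup of `S`. -/
def sub (U : Opens X.space) : Subgroup (P.S.grp U) := (P.N.grp U).subgroupOf (P.S.grp U)

instance (U : Opens X.space) : (P.sub U).Normal where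
  conj_mem n hn g := by
    have h1 := P.comm g.2 n.2
    have h2 := mul_mem h1 (Subgroup.mem_subgroupOf.mp hn)
    refine Subgroup.mem_subgroupOf.mpr ?_
    simpa [mul_assoc] using h2

/-- The quotient group `S(U) / N(U)`, which is abelian. -/
def Quot (U : Opens X.space) : Type u := P.S.grp U ⧸ P.sub U

instance (U : Opens X.space) : CommGroup (P.Quot U) :=
  { (inferInstance : Group (P.S.grp U ⧸ P.sub U)) with
    mul_comm := fun a b => by
      induction a using QuotientGroup.induction_on with | H a => ?_
      induction b using QuotientGroup.induction_on with | H b => ?_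
      change ((a * b : P.S.grp U) : P.S.grp U ⧸ P.sub U) = ((b * a : P.S.grp U) : _)
      rw [QuotientGroup.eq]
      have h := P.comm (inv_mem b.2) (inv_mem a.2)
      refine Subgroup.mem_subgroupOf.mpr ?_
      simpa [mul_assoc] using h }

/-- The projection `S(U) → S(U) / N(U)`. -/
def proj (U : Opens X.space) : P.S.grp U →* P.Quot U := QuotientGroup.mk' (P.sub U)

/-- Restriction maps of the quotients. -/
def quotRes {U V : Opens X.space} (h : V ≤ U) : P.Quot U →* P.Quot V :=
  QuotientGroup.map (P.sub U) (P.sub V)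
    (((PreAut.res h).comp (P.S.grp U).subtype).codRestrict (P.S.grp V)
      fun α => P.S.res_mem h α.2)
    (fun _ hα => Subgroup.mem_subgroupOf.mpr (P.N.res_mem h (Subgroup.mem_subgroupOf.mp hα)))

theorem quotRes_id (U : Opens X.space) (a : P.Quot U) : P.quotRes le_rfl a = a := by
  induction a using QuotientGroup.induction_on with | H a => rfl

theorem quotRes_quotRes {U V W : Opens X.space} (h : V ≤ U) (h' : W ≤ V) (a : P.Quot U) :
    P.quotRes (h'.trans h) a = P.quotRes h' (P.quotRes h a) := by
  induction a using QuotientGroup.induction_on with | H a => rfl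

/-- The presheaf of abelian groups `U ↦ S(U) / N(U)`, written additively. -/
def quotPresheaf : (Opens X.space)ᵒᵖ ⥤ AddCommGrpCat.{u} where
  obj U := AddCommGrpCat.of (Additive (P.Quot U.unop))
  map {U V} h := AddCommGrpCat.ofHom (P.quotRes (leOfHom h.unop)).toAdditive
  map_id U := AddCommGrpCat.hom_ext (AddMonoidHom.ext fun a => P.quotRes_id U.unop a.toMul)
  map_comp f g := AddCommGrpCat.hom_ext (AddMonoidHom.ext fun a =>
    P.quotRes_quotRes (leOfHom f.unop) (leOfHom g.unop) a.toMul)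

/-- The quotient sheaf `S / N`. -/
def sheaf : TopCat.Sheaf AddCommGrpCat.{u} X.space :=
  (presheafToSheaf (Opens.grothendieckTopology X.space) AddCommGrpCat.{u}).obj P.quotPresheaf

end AutPair

end Supergeometry

/-- A holomorphic embedding of supergeometries `f = (i, f^♯) : (Y, T*_{Y,-}) ⊂ (X, T*_{X,-})`:
a holomorphic embedding `i` of `Y` onto a closed subspace of `X`, such that `𝒪_X → i_* 𝒪_Y` is a
surjection of sheaves, together with a surjection of sheaves `f^♯ : T*_{X,-} → i_* T*_{Y,-}`, given
by linear maps of the fibres. -/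
structure SuperEmbedding (Y X : Supergeometry.{u}) where
  /-- the embedding `i : Y → X` of spaces -/
  base : Y.space ⟶ X.space
  isClosedEmbedding : Topology.IsClosedEmbedding base
  holomorphic : ContMDiff Y.I X.I ω base
  /-- every holomorphic function on an open subset of `Y` extends locally to `X` -/
  fun_surjective : ∀ (V : Opens Y.space) (g : V → ℂ), Supergeometry.IsHolFun g → ∀ y ∈ V,
    ∃ (W : Opens X.space) (g' : W → ℂ), base y ∈ W ∧ Supergeometry.IsHolFun g' ∧
      ∀ (z : Y.space) (hz : z ∈ V) (hz' : base z ∈ W), g' ⟨base z, hz'⟩ = g ⟨z, hz⟩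
  /-- the map `f^♯` on fibres -/
  fib : ∀ y : Y.space, X.fiber (base y) →ₗ[ℂ] Y.fiber y
  fib_holomorphic : ∀ (U : Opens X.space) (σ : ∀ x : U, X.fiber x), Supergeometry.IsHolSec σ →
    Supergeometry.IsHolSec (X := Y) (U := (Opens.map base).obj U)
      (fun y => fib y (σ ⟨base y, y.2⟩))
  /-- every holomorphic section of `T*_{Y,-}` is locally the image of a section of `T*_{X,-}` -/
  fib_surjective : ∀ (V : Opens Y.space) (σ : ∀ y : V, Y.fiber y), Supergeometry.IsHolSec σ →
    ∀ y ∈ V, ∃ (W : Opens X.space) (σ' : ∀ x : W, X.fiber x), base y ∈ W ∧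
      Supergeometry.IsHolSec σ' ∧
      ∀ (z : Y.space) (hz : z ∈ V) (hz' : base z ∈ W), fib z (σ' ⟨base z, hz'⟩) = σ ⟨z, hz⟩

namespace SuperEmbedding

open Supergeometry ExteriorFiltration

variable {Y X : Supergeometry.{u}} (f : SuperEmbedding Y X)

/-- The inverse image `i⁻¹ U` of an open set. -/
abbrev pre (U : Opens X.space) : Opens Y.space := (Opens.map f.base).obj U

theorem pre_mono {U V : Opens X.space} (h : V ≤ U) : f.pre V ≤ f.pre U := fun _ hy => h hy

theorem isHolFun_comp {U : Opens X.space} {g : U → ℂ} (hg : IsHolFun g) :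
    IsHolFun (X := Y) (U := f.pre U) (fun y => g ⟨f.base y, y.2⟩) := by
  have h1 : ContMDiff Y.I X.I ω (fun y : f.pre U => f.base y) :=
    f.holomorphic.comp contMDiff_subtype_val
  have h2 : ContMDiff Y.I X.I ω (fun y : f.pre U => (⟨f.base y, y.2⟩ : U)) := fun y =>
    (ChartedSpace.liftPropWithinAt_subtypeVal_comp_iff _ _ _).mp (h1 y)
  exact ContMDiff.comp hg h2

/-- Pull back of families. -/
def famPull (U : Opens X.space) : Families U →ₐ[ℂ] Families (f.pre U) :=
  AlgHom.pi fun y => (ExteriorAlgebra.map (f.fib y)).comp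
    (Pi.evalAlgHom ℂ (fun x : U => ExteriorAlgebra ℂ (X.fiber x)) ⟨f.base y, y.2⟩)

theorem famPull_adjoin {U : Opens X.space} {s : Families U}
    (hs : s ∈ Algebra.adjoin ℂ (gens U)) : f.famPull U s ∈ Algebra.adjoin ℂ (gens (f.pre U)) := by
  have : Algebra.adjoin ℂ (gens U) ≤
      (Algebra.adjoin ℂ (gens (f.pre U))).comap (f.famPull U) := by
    refine Algebra.adjoin_le ?_
    rintro s (⟨g, hg, rfl⟩ | ⟨σ, hσ, rfl⟩)
    · refine Algebra.subset_adjoin (Or.inl ⟨_, f.isHolFun_comp hg, ?_⟩)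
      funext y
      exact AlgHom.commutes _ _
    · refine Algebra.subset_adjoin (Or.inr ⟨_, f.fib_holomorphic U σ hσ, ?_⟩)
      funext y
      exact ExteriorAlgebra.map_apply_ι _ _
  exact this hs

/-- The surjection `⋀^• T*_{X,-} → i_* ⋀^• T*_{Y,-}` induced by `f`, on sections over `U`. -/
def pull (U : Opens X.space) : Λ U →ₐ[ℂ] Λ (f.pre U) :=
  ((f.famPull U).comp (Λ U).val).codRestrict (Λ (f.pre U)) fun s y hy => by
    obtain ⟨W, hyW, hW, h1⟩ := s.2 (f.base y) hy
    exact ⟨f.pre W, hyW, f.pre_mono hW, f.famPull_adjoin h1⟩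

@[simp] theorem pull_apply {U : Opens X.space} (s : Λ U) (y : f.pre U) :
    (f.pull U s).1 y = ExteriorAlgebra.map (f.fib y) (s.1 ⟨f.base y, y.2⟩) := rfl

theorem res_pull {U V : Opens X.space} (h : V ≤ U) (s : Λ U) :
    Supergeometry.res (f.pre_mono h) (f.pull U s) = f.pull V (Supergeometry.res h s) := rfl

theorem pull_parity {U : Opens X.space} (s : Λ U) :
    f.pull U (parity U s) = parity (f.pre U) (f.pull U s) :=
  Subtype.ext (funext fun _ => map_inv _ _)

theorem pull_J {k : ℕ} {U : Opens X.space} {s : Λ U} (hs : s ∈ J k U) :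
    f.pull U s ∈ J k (f.pre U) := fun y => map_mem_degGE _ (hs ⟨f.base y, y.2⟩)

/-- `t` is a lifting of `s` to `W`. -/
def IsLift {V : Opens Y.space} (s : Λ V) {W : Opens X.space} (hW : f.pre W ≤ V) (t : Λ W) : Prop :=
  f.pull W t = Supergeometry.res hW s

theorem exists_lift_aux {V : Opens Y.space} {s : Families V}
    (hs : s ∈ Algebra.adjoin ℂ (gens V)) : ∀ y ∈ V, ∃ (W : Opens X.space) (t : Λ W), f.base y ∈ W ∧
      ∀ (z : Y.space) (hz : z ∈ V) (hz' : f.base z ∈ W),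
        ExteriorAlgebra.map (f.fib z) (t.1 ⟨f.base z, hz'⟩) = s ⟨z, hz⟩ := by
  induction hs using Algebra.adjoin_induction with
  | mem s hs =>
    intro y hy
    rcases hs with ⟨g, hg, rfl⟩ | ⟨σ, hσ, rfl⟩
    · obtain ⟨W, g', hyW, hg', e⟩ := f.fun_surjective V g hg y hy
      refine ⟨W, ⟨_, adjoin_le_Λ (Algebra.subset_adjoin (Or.inl ⟨g', hg', rfl⟩))⟩, hyW, ?_⟩
      intro z hz hz'
      exact (AlgHom.commutes _ _).trans (congrArg (algebraMap ℂ _) (e z hz hz'))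
    · obtain ⟨W, σ', hyW, hσ', e⟩ := f.fib_surjective V σ hσ y hy
      refine ⟨W, ⟨_, adjoin_le_Λ (Algebra.subset_adjoin (Or.inr ⟨σ', hσ', rfl⟩))⟩, hyW, ?_⟩
      intro z hz hz'
      exact (ExteriorAlgebra.map_apply_ι _ _).trans (congrArg (ExteriorAlgebra.ι ℂ) (e z hz hz'))
  | algebraMap r =>
    exact fun y _ => ⟨⊤, algebraMap ℂ _ r, trivial, fun z _ _ => AlgHom.commutes _ _⟩
  | add s s' _ _ ih ih' =>
    intro y hy
    obtain ⟨W, t, hW, e⟩ := ih y hy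
    obtain ⟨W', t', hW', e'⟩ := ih' y hy
    refine ⟨W ⊓ W', Supergeometry.res inf_le_left t + Supergeometry.res inf_le_right t',
      ⟨hW, hW'⟩, fun z hz hz' => ?_⟩
    exact (_root_.map_add _ _ _).trans (congrArg₂ (· + ·) (e z hz hz'.1) (e' z hz hz'.2))
  | mul s s' _ _ ih ih' =>
    intro y hy
    obtain ⟨W, t, hW, e⟩ := ih y hy
    obtain ⟨W', t', hW', e'⟩ := ih' y hy
    refine ⟨W ⊓ W', Supergeometry.res inf_le_left t * Supergeometry.res inf_le_right t',
      ⟨hW, hW'⟩, fun z hz hz' => ?_⟩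
    exact (_root_.map_mul _ _ _).trans (congrArg₂ (· * ·) (e z hz hz'.1) (e' z hz hz'.2))

/-- Sections of `⋀^• T*_{Y,-}` lift locally. -/
theorem exists_lift {U : Opens X.space} {V : Opens Y.space} (hV : V ≤ f.pre U) (s : Λ V) :
    ∀ y ∈ V, ∃ (W : Opens X.space) (_ : W ≤ U) (hWV : f.pre W ≤ V) (t : Λ W), f.base y ∈ W ∧
      f.IsLift s hWV t := by
  intro y hy
  obtain ⟨V', hyV', hV', h1⟩ := s.2 y hy
  obtain ⟨W, t, hyW, e⟩ := f.exists_lift_aux h1 y hyV'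
  obtain ⟨O, hO, hOV⟩ := f.isClosedEmbedding.isInducing.isOpen_iff.mp V'.isOpen
  have hO' : ∀ z, f.base z ∈ O ↔ z ∈ V' := fun z => by
    rw [← SetLike.mem_coe (p := V'), ← hOV]; rfl
  refine ⟨W ⊓ ⟨O, hO⟩ ⊓ U, inf_le_right, fun z hz => hV' ((hO' z).mp hz.1.2),
    Supergeometry.res (inf_le_left.trans inf_le_left) t, ⟨⟨hyW, (hO' y).mpr hyV'⟩, hV hy⟩, ?_⟩
  refine Subtype.ext (funext fun z => ?_)
  exact e z ((hO' z).mp z.2.1.2) z.2.1.1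

/-- The automorphisms of `⋀^• T*_{X,-}` which preserve the kernel of
`⋀^• T*_{X,-} → i_* ⋀^• T*_{Y,-}`. -/
def relAut (U : Opens X.space) : Subgroup (PreAut U) where
  carrier := {α | α ∈ AutSheaf U ∧
    ∀ (W : {W : Opens X.space // W ≤ U}) (s : Λ W.1), f.pull W.1 (α W s) = 0 ↔ f.pull W.1 s = 0}
  one_mem' := ⟨one_mem _, fun _ _ => Iff.rfl⟩
  mul_mem' {α β} hα hβ := ⟨mul_mem hα.1 hβ.1, fun W s => (hα.2 W (β W s)).trans (hβ.2 W s)⟩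
  inv_mem' {α} hα := ⟨inv_mem hα.1, fun W s => by
    change f.pull W.1 ((α W).symm s) = 0 ↔ _
    rw [← hα.2 W, AlgEquiv.apply_symm_apply]⟩

variable {f} in
theorem relAut_congr {U : Opens X.space} {α : PreAut U} (hα : α ∈ f.relAut U)
    {W W' : {W : Opens X.space // W ≤ U}} {t : Λ W.1} {t' : Λ W'.1} {y : Y.space}
    (hy : f.base y ∈ W.1) (hy' : f.base y ∈ W'.1)
    (h : ∀ (z : Y.space) (hz : f.base z ∈ W.1) (hz' : f.base z ∈ W'.1),
      (f.pull W.1 t).1 ⟨z, hz⟩ = (f.pull W'.1 t').1 ⟨z, hz'⟩) :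
    (f.pull W.1 (α W t)).1 ⟨y, hy⟩ = (f.pull W'.1 (α W' t')).1 ⟨y, hy'⟩ := by
  set V : {W : Opens X.space // W ≤ U} := ⟨W.1 ⊓ W'.1, inf_le_left.trans W.2⟩
  have h1 : f.pull V.1 (Supergeometry.res inf_le_left t - Supergeometry.res inf_le_right t') = 0 := by
    refine Subtype.ext (funext fun z => ?_)
    rw [map_sub]
    exact sub_eq_zero.mpr (h z z.2.1 z.2.2)
  rw [← hα.2 V, map_sub, map_sub, sub_eq_zero] at h1
  have e1 := hα.1.1 W V.1 inf_le_left t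
  have e2 := hα.1.1 W' V.1 inf_le_right t'
  change _ = α V _ at e1
  change _ = α V _ at e2
  rw [← e1, ← e2] at h1
  exact congrFun (congrArg Subtype.val h1) ⟨y, hy, hy'⟩

/-- The map of sections of `⋀^• T*_{Y,-}` over `V ⊆ i⁻¹ U` induced by `α`: lift locally to `X`,
apply `α` and restrict to `Y`. -/
def indFun {U : Opens X.space} (α : PreAut U) {V : Opens Y.space} (hV : V ≤ f.pre U) (s : Λ V) :
    Families V := fun y =>
  let h := f.exists_lift hV s y y.2
  (f.pull h.choose (α ⟨h.choose, h.choose_spec.choose⟩ h.choose_spec.choose_spec.choose_spec.choose)).1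
    ⟨y, h.choose_spec.choose_spec.choose_spec.choose_spec.1⟩

variable {f}

theorem indFun_eq {U : Opens X.space} {α : PreAut U} (hα : α ∈ f.relAut U) {V : Opens Y.space}
    (hV : V ≤ f.pre U) (s : Λ V) {W : Opens X.space} (hW : W ≤ U) (hWV : f.pre W ≤ V) {t : Λ W}
    (ht : f.IsLift s hWV t) (y : Y.space) (hy : f.base y ∈ W) :
    f.indFun α hV s ⟨y, hWV hy⟩ = (f.pull W (α ⟨W, hW⟩ t)).1 ⟨y, hy⟩ := by
  let h := f.exists_lift hV s y (hWV hy)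
  refine relAut_congr hα (W := ⟨h.choose, h.choose_spec.choose⟩) (W' := ⟨W, hW⟩) _ hy ?_
  intro z hz hz'
  have e1 : f.pull _ _ = _ := h.choose_spec.choose_spec.choose_spec.choose_spec.2
  have e2 : f.pull _ _ = _ := ht
  have e1' := congrFun (congrArg Subtype.val e1) ⟨z, hz⟩
  have e2' := congrFun (congrArg Subtype.val e2) ⟨z, hz'⟩
  exact e1'.trans e2'.symm

theorem mem_Λ_of_local {V : Opens Y.space} {s : Families V}
    (h : ∀ y ∈ V, ∃ (W : Opens Y.space) (hW : W ≤ V), y ∈ W ∧ famRes hW s ∈ Λ W) : s ∈ Λ V := by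
  intro y hy
  obtain ⟨W, hW, hyW, h1⟩ := h y hy
  obtain ⟨W', hyW', hW', h2⟩ := h1 y hyW
  exact ⟨W', hyW', hW'.trans hW, h2⟩

theorem indFun_mem {U : Opens X.space} {α : PreAut U} (hα : α ∈ f.relAut U) {V : Opens Y.space}
    (hV : V ≤ f.pre U) (s : Λ V) : f.indFun α hV s ∈ Λ V := by
  refine mem_Λ_of_local fun y hy => ?_
  obtain ⟨W, hW, hWV, t, hyW, ht⟩ := f.exists_lift hV s y hy
  refine ⟨f.pre W, hWV, hyW, ?_⟩
  have : famRes hWV (f.indFun α hV s) = (f.pull W (α ⟨W, hW⟩ t)).1 :=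
    funext fun z => indFun_eq hα hV s hW hWV ht z z.2
  rw [this]
  exact Subtype.property _

theorem IsLift.res {V : Opens Y.space} {s : Λ V} {W W' : Opens X.space} {hW : f.pre W ≤ V} {t : Λ W}
    (ht : f.IsLift s hW t) (h : W' ≤ W) :
    f.IsLift s ((f.pre_mono h).trans hW) (Supergeometry.res h t) := by
  unfold IsLift at ht ⊢
  rw [← f.res_pull h, ht, Supergeometry.res_res]

variable (f) in
theorem exists_lift₂ {U : Opens X.space} {V : Opens Y.space} (hV : V ≤ f.pre U) (s s' : Λ V) :
    ∀ y ∈ V, ∃ (W : Opens X.space) (_ : W ≤ U) (hWV : f.pre W ≤ V) (t t' : Λ W), f.base y ∈ W ∧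
      f.IsLift s hWV t ∧ f.IsLift s' hWV t' := by
  intro y hy
  obtain ⟨W, hW, hWV, t, hyW, ht⟩ := f.exists_lift hV s y hy
  obtain ⟨W', hW', hWV', t', hyW', ht'⟩ := f.exists_lift hV s' y hy
  exact ⟨W ⊓ W', inf_le_left.trans hW, (f.pre_mono inf_le_left).trans hWV,
    Supergeometry.res inf_le_left t, Supergeometry.res inf_le_right t', ⟨hyW, hyW'⟩,
    ht.res inf_le_left, ht'.res inf_le_right⟩

/-- The section of `⋀^• T*_{Y,-}` induced by `α` from a section. -/
def ind {U : Opens X.space} {α : PreAut U} (hα : α ∈ f.relAut U) {V : Opens Y.space}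
    (hV : V ≤ f.pre U) (s : Λ V) : Λ V := ⟨f.indFun α hV s, indFun_mem hα hV s⟩

theorem ind_eq {U : Opens X.space} {α : PreAut U} (hα : α ∈ f.relAut U) {V : Opens Y.space}
    (hV : V ≤ f.pre U) {s : Λ V} {W : Opens X.space} (hW : W ≤ U) {hWV : f.pre W ≤ V} {t : Λ W}
    (ht : f.IsLift s hWV t) : f.IsLift (ind hα hV s) hWV (α ⟨W, hW⟩ t) :=
  Subtype.ext (funext fun y => (indFun_eq hα hV s hW hWV ht y y.2).symm)

theorem ext_pre {V : Opens Y.space} {s s' : Λ V}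
    (h : ∀ y ∈ V, ∃ (W : Opens X.space) (_ : f.base y ∈ W) (hWV : f.pre W ≤ V),
      Supergeometry.res hWV s = Supergeometry.res hWV s') : s = s' :=
  ext_local fun y hy => by
    obtain ⟨W, hyW, hWV, e⟩ := h y hy
    exact ⟨f.pre W, hyW, hWV, e⟩

section

variable {U : Opens X.space} {α β : PreAut U} (hα : α ∈ f.relAut U) (hβ : β ∈ f.relAut U)
  {V : Opens Y.space} (hV : V ≤ f.pre U)

theorem ind_map_one : ind hα hV 1 = 1 := by
  refine ext_pre (f := f) fun y hy => ?_
  obtain ⟨W, hW, hWV, -, hyW, -⟩ := f.exists_lift hV (1 : Λ V) y hy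
  have ht : f.IsLift (1 : Λ V) hWV 1 := by
    unfold IsLift
    rw [_root_.map_one, _root_.map_one]
  have e : f.pull W _ = _ := ind_eq hα hV hW ht
  rw [_root_.map_one, _root_.map_one] at e
  exact ⟨W, hyW, hWV, by rw [← e, _root_.map_one]⟩

theorem ind_map_mul (s s' : Λ V) : ind hα hV (s * s') = ind hα hV s * ind hα hV s' := by
  refine ext_pre (f := f) fun y hy => ?_
  obtain ⟨W, hW, hWV, t, t', hyW, ht, ht'⟩ := f.exists_lift₂ hV s s' y hy
  have ht'' : f.IsLift (s * s') hWV (t * t') := by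
    unfold IsLift at ht ht' ⊢
    rw [_root_.map_mul, _root_.map_mul, ht, ht']
  have e : f.pull W _ = _ := ind_eq hα hV hW ht
  have e' : f.pull W _ = _ := ind_eq hα hV hW ht'
  have e'' : f.pull W _ = _ := ind_eq hα hV hW ht''
  exact ⟨W, hyW, hWV, by rw [← e'', _root_.map_mul, _root_.map_mul, _root_.map_mul, e, e']⟩

theorem ind_map_add (s s' : Λ V) : ind hα hV (s + s') = ind hα hV s + ind hα hV s' := by
  refine ext_pre (f := f) fun y hy => ?_
  obtain ⟨W, hW, hWV, t, t', hyW, ht, ht'⟩ := f.exists_lift₂ hV s s' y hy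
  have ht'' : f.IsLift (s + s') hWV (t + t') := by
    unfold IsLift at ht ht' ⊢
    rw [_root_.map_add, _root_.map_add, ht, ht']
  have e : f.pull W _ = _ := ind_eq hα hV hW ht
  have e' : f.pull W _ = _ := ind_eq hα hV hW ht'
  have e'' : f.pull W _ = _ := ind_eq hα hV hW ht''
  exact ⟨W, hyW, hWV, by rw [← e'', _root_.map_add, _root_.map_add, _root_.map_add, e, e']⟩

theorem ind_map_smul (c : ℂ) (s : Λ V) : ind hα hV (c • s) = c • ind hα hV s := by
  refine ext_pre (f := f) fun y hy => ?_
  obtain ⟨W, hW, hWV, t, hyW, ht⟩ := f.exists_lift hV s y hy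
  have ht'' : f.IsLift (c • s) hWV (c • t) := by
    unfold IsLift at ht ⊢
    rw [_root_.map_smul, _root_.map_smul, ht]
  have e : f.pull W _ = _ := ind_eq hα hV hW ht
  have e'' : f.pull W _ = _ := ind_eq hα hV hW ht''
  exact ⟨W, hyW, hWV, by rw [← e'', _root_.map_smul, _root_.map_smul, _root_.map_smul, e]⟩

theorem ind_ind (s : Λ V) : ind hα hV (ind hβ hV s) = ind (mul_mem hα hβ) hV s := by
  refine ext_pre (f := f) fun y hy => ?_
  obtain ⟨W, hW, hWV, t, hyW, ht⟩ := f.exists_lift hV s y hy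
  have e : f.pull W _ = _ := ind_eq hα hV hW (ind_eq hβ hV hW ht)
  have e' : f.pull W _ = _ := ind_eq (mul_mem hα hβ) hV hW ht
  exact ⟨W, hyW, hWV, e.symm.trans e'⟩

theorem ind_one (s : Λ V) : ind (one_mem (f.relAut U)) hV s = s := by
  refine ext_pre (f := f) fun y hy => ?_
  obtain ⟨W, hW, hWV, t, hyW, ht⟩ := f.exists_lift hV s y hy
  have e : f.pull W _ = _ := ind_eq (one_mem (f.relAut U)) hV hW ht
  exact ⟨W, hyW, hWV, e.symm.trans ht⟩

theorem ind_congr (h : α = β) (s : Λ V) : ind hα hV s = ind hβ hV s := by subst h; rfl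

theorem ind_parity (s : Λ V) : ind hα hV (parity V s) = parity V (ind hα hV s) := by
  refine ext_pre (f := f) fun y hy => ?_
  obtain ⟨W, hW, hWV, t, hyW, ht⟩ := f.exists_lift hV s y hy
  have ht'' : f.IsLift (parity V s) hWV (parity W t) := by
    unfold IsLift at ht ⊢
    rw [pull_parity, ht, res_parity]
  have e : f.pull W _ = _ := ind_eq hα hV hW ht
  have e'' : f.pull W _ = _ := ind_eq hα hV hW ht''
  rw [hα.1.2, pull_parity, e] at e''
  exact ⟨W, hyW, hWV, e''.symm⟩

theorem res_ind {V' : Opens Y.space} (h : V' ≤ V) (s : Λ V) :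
    Supergeometry.res h (ind hα hV s) = ind hα (h.trans hV) (Supergeometry.res h s) := by
  refine ext_pre (f := f) fun y hy => ?_
  obtain ⟨W, hW, hWV, t, hyW, ht⟩ := f.exists_lift (h.trans hV) (Supergeometry.res h s) y hy
  have ht' : f.IsLift s (hWV.trans h) t := ht
  have e : f.pull W _ = _ := ind_eq hα hV hW ht'
  have e'' : f.pull W _ = _ := ind_eq hα (h.trans hV) hW ht
  exact ⟨W, hyW, hWV, e.symm.trans e''⟩

theorem ind_sub_mem_J {k : ℕ} (hαk : α ∈ green k U) (s : Λ V) : ind hα hV s - s ∈ J k V := by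
  refine mem_J_local fun y hy => ?_
  obtain ⟨W, hW, hWV, t, hyW, ht⟩ := f.exists_lift hV s y hy
  have e : f.pull W _ = _ := ind_eq hα hV hW ht
  refine ⟨f.pre W, hyW, hWV, ?_⟩
  have ht' : f.pull W t = _ := ht
  rw [_root_.map_sub, ← e, ← ht', ← _root_.map_sub]
  exact f.pull_J (hαk.2 ⟨W, hW⟩ t)

/-- The automorphism of `Γ(V, ⋀^• T*_{Y,-})` induced by `α`. -/
def indEquiv : Λ V ≃ₐ[ℂ] Λ V where
  toFun := ind hα hV
  invFun := ind (inv_mem hα) hV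
  left_inv s := by
    rw [ind_ind, ind_congr _ (one_mem (f.relAut U)) hV (inv_mul_cancel α), ind_one]
  right_inv s := by
    rw [ind_ind, ind_congr _ (one_mem (f.relAut U)) hV (mul_inv_cancel α), ind_one]
  map_mul' := ind_map_mul hα hV
  map_add' := ind_map_add hα hV
  commutes' c := by
    rw [Algebra.algebraMap_eq_smul_one, ind_map_smul, ind_map_one]

end

variable (f)

/-- The restriction of automorphisms of `⋀^• T*_{X,-}|_U` preserving the kernel of
`⋀^• T*_{X,-} → i_* ⋀^• T*_{Y,-}` to automorphisms of `⋀^• T*_{Y,-}|_{i⁻¹U}`. -/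
def relRes (U : Opens X.space) : f.relAut U →* PreAut (f.pre U) where
  toFun α V := indEquiv α.2 V.2
  map_one' := funext fun V => AlgEquiv.ext fun s => ind_one V.2 s
  map_mul' α β := funext fun V => AlgEquiv.ext fun s => (ind_ind α.2 β.2 V.2 s).symm

/-- The sheaf of groups `𝒢^{(k)}_{T*_{Y,-}; T*_{X,-}}`: the elements of Green's group `𝒢^{(k)}` of
`X` which preserve the kernel of `⋀^• T*_{X,-} → i_* ⋀^• T*_{Y,-}`. -/
def relGreen (k : ℕ) : AutFamily X where
  grp U := green k U ⊓ f.relAut U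
  res_mem h _ hα := ⟨(greenFamily X k).res_mem h hα.1,
    ((greenFamily X k).res_mem h hα.1).1, fun W => hα.2.2 ⟨W.1, W.2.trans h⟩⟩

theorem relRes_mem {k : ℕ} {U : Opens X.space} (α : f.relAut U) (hα : α.1 ∈ green k U) :
    f.relRes U α ∈ green k (f.pre U) :=
  ⟨⟨fun V _ h s => res_ind α.2 V.2 h s, fun V s => ind_parity α.2 V.2 s⟩,
    fun V s => ind_sub_mem_J α.2 V.2 hα s⟩

/-- The restriction `r : 𝒢^{(k)}_{T*_{Y,-}; T*_{X,-}}(U) → 𝒢^{(k)}_{T*_{Y,-}}(i⁻¹ U)`. -/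
def greenRes (k : ℕ) (U : Opens X.space) : (f.relGreen k).grp U →* (greenFamily Y k).grp (f.pre U) :=
  ((f.relRes U).comp (Subgroup.inclusion (inf_le_right : (f.relGreen k).grp U ≤ f.relAut U))
    ).codRestrict _ fun α => f.relRes_mem _ α.2.1

theorem greenRes_res (k : ℕ) {U U' : Opens X.space} (h : U' ≤ U) (α : (f.relGreen k).grp U) :
    PreAut.res (f.pre_mono h) (f.greenRes k U α).1 =
      (f.greenRes k U' ⟨PreAut.res h α.1, (f.relGreen k).res_mem h α.2⟩).1 := by
  funext V
  refine AlgEquiv.ext fun s => ?_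
  refine ext_pre (f := f) fun y hy => ?_
  obtain ⟨W, hW, hWV, t, hyW, ht⟩ := f.exists_lift V.2 s y hy
  have e : f.pull W _ = _ := ind_eq α.2.2 (V.2.trans (f.pre_mono h)) (hW.trans h) ht
  have e' : f.pull W _ = _ := ind_eq ((f.relGreen k).res_mem h α.2).2 V.2 hW ht
  exact ⟨W, hyW, hWV, e.symm.trans e'⟩

/-- The restriction as a morphism of (pre)sheaves of groups on `X`, from
`𝒢^{(k)}_{T*_{Y,-}; T*_{X,-}}` to the direct image of `𝒢^{(k)}_{T*_{Y,-}}`. -/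
def greenResHom (k : ℕ) :
    (f.relGreen k).presheaf ⟶ (Opens.map f.base).op ⋙ (greenFamily Y k).presheaf where
  app U := GrpCat.ofHom (X := (f.relGreen k).grp U.unop)
    (Y := (greenFamily Y k).grp (f.pre U.unop)) (f.greenRes k U.unop)
  naturality U V h := by
    refine GrpCat.hom_ext (MonoidHom.ext fun α => Subtype.ext ?_)
    exact (f.greenRes_res k (leOfHom h.unop) α).symm

end SuperEmbedding

/-- A pushout of a short exact sequence is short exact. -/
theorem pushout_shortExact {C : Type*} [Category C] [Abelian C] {A A' B R : C} (a : A ⟶ A')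
    (i : A ⟶ B) [Mono i] (q : B ⟶ R) [Epi q] (w : i ≫ q = 0)
    (hq : IsColimit (CokernelCofork.ofπ q w)) :
    (ShortComplex.mk (pushout.inl a i) (pushout.desc 0 q (by rw [comp_zero, w]))
      (pushout.inl_desc _ _ _)).ShortExact := by
  have hepi : Epi (pushout.desc (f := a) (g := i) 0 q (by rw [comp_zero, w])) :=
    epi_of_epi_fac (pushout.inr_desc _ _ _)
  refine ShortComplex.ShortExact.mk' (ShortComplex.exact_of_g_is_cokernel _
    (CokernelCofork.IsColimit.ofπ' (hp := hepi) _ _ fun {T} t ht => ?_))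
    (Abelian.mono_pushout_of_mono_g _ _) hepi
  have ht' : pushout.inl a i ≫ t = 0 := ht
  have h1 : i ≫ pushout.inr a i ≫ t = 0 := by
    rw [← pushout.condition_assoc, ht', comp_zero]
  obtain ⟨c, hc⟩ := CokernelCofork.IsColimit.desc' hq _ h1
  have hc' : q ≫ c = pushout.inr a i ≫ t := hc
  refine ⟨c, pushout.hom_ext ?_ ?_⟩
  · rw [ht', pushout.inl_desc_assoc, zero_comp]
  · rw [← hc', pushout.inr_desc_assoc]

namespace Supergeometry

variable {X : Supergeometry.{u}}

/-- The map of quotients induced by inclusions `S ⊆ S'`, `N ⊆ N'`. -/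
def AutPair.quotMap {P P' : AutPair X} (hS : ∀ U, P.S.grp U ≤ P'.S.grp U)
    (hN : ∀ U, P.N.grp U ≤ P'.N.grp U) (U : Opens X.space) : P.Quot U →* P'.Quot U :=
  QuotientGroup.map (P.sub U) (P'.sub U) (Subgroup.inclusion (hS U))
    (fun _ hα => Subgroup.mem_subgroupOf.mpr (hN U (Subgroup.mem_subgroupOf.mp hα)))

/-- The morphism of quotient presheaves induced by inclusions. -/
def AutPair.quotPresheafMap {P P' : AutPair X} (hS : ∀ U, P.S.grp U ≤ P'.S.grp U)
    (hN : ∀ U, P.N.grp U ≤ P'.N.grp U) : P.quotPresheaf ⟶ P'.quotPresheaf where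
  app U := AddCommGrpCat.ofHom (X := Additive (P.Quot U.unop)) (Y := Additive (P'.Quot U.unop))
    (AutPair.quotMap hS hN U.unop).toAdditive
  naturality U V h := by
    refine AddCommGrpCat.hom_ext (AddMonoidHom.ext fun a => ?_)
    obtain ⟨α, rfl⟩ := QuotientGroup.mk_surjective (s := P.sub U.unop) a.toMul
    rfl

/-- The canonical map from `S` to the quotient sheaf `S / N`, on sections over `U`. -/
def AutPair.toSheafHom (P : AutPair X) (U : Opens X.space) :
    P.S.grp U →* Multiplicative (Cech.sec P.sheaf U) where
  toFun α := Multiplicative.ofAdd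
    (((toSheafify (Opens.grothendieckTopology X.space) P.quotPresheaf).app (op U)).hom
      (Additive.ofMul (P.proj U α)))
  map_one' := by
    rw [map_one]
    exact map_zero ((toSheafify (Opens.grothendieckTopology X.space) P.quotPresheaf).app (op U)).hom
  map_mul' α β := by
    rw [map_mul]
    exact map_add ((toSheafify (Opens.grothendieckTopology X.space) P.quotPresheaf).app (op U)).hom
      (Additive.ofMul (P.proj U α)) (Additive.ofMul (P.proj U β))

/-- The canonical map from `S` to the quotient sheaf `S / N`. -/
def AutPair.toSheaf (P : AutPair X) : P.S.presheaf ⟶ Cech.grp P.sheaf where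
  app U := GrpCat.ofHom (X := P.S.grp U.unop) (Y := Multiplicative (Cech.sec P.sheaf U.unop))
    (P.toSheafHom U.unop)
  naturality U V h := by
    refine GrpCat.hom_ext (MonoidHom.ext fun α => ?_)
    exact congrFun (congrArg (fun f => (f.hom : _ → _))
      ((toSheafify (Opens.grothendieckTopology X.space) P.quotPresheaf).naturality h))
      (Additive.ofMul (P.proj U.unop α))

/-- The pair `𝒢^{(k+1)} ⊆ 𝒢^{(k)}`, `k ≥ 2`. -/
def greenPair (X : Supergeometry.{u}) (k : ℕ) (hk : 2 ≤ k) : AutPair X where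
  S := greenFamily X k
  N := greenFamily X (k + 1)
  le := green_anti (Nat.le_succ k)
  comm := green_commutator hk

/-- The `k`-th obstruction sheaf `𝒬^{(k)} = 𝒢^{(k)} / 𝒢^{(k+1)}` of a supergeometry. -/
abbrev Q (X : Supergeometry.{u}) (k : ℕ) (hk : 2 ≤ k) : TopCat.Sheaf AddCommGrpCat.{u} X.space :=
  (X.greenPair k hk).sheaf

/-- The set `Ȟ¹(X, 𝒢^{(k)})` of `(k-1)`-split supermanifolds modelled on `(X, T*_{X,-})`, that is
of supermanifolds of splitting type `k-1`. -/
def SplitSupermanifold (X : Supergeometry.{u}) (k : ℕ) : Type u := Cech.H1 (greenFamily X k).presheaf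

/-- A `(l-1)`-split supermanifold as a `(k-1)`-split supermanifold, for `k ≤ l`. -/
def SplitSupermanifold.coarsen {k l : ℕ} (h : k ≤ l) (𝔛 : X.SplitSupermanifold l) :
    X.SplitSupermanifold k :=
  Cech.H1.map (AutFamily.incl (S := greenFamily X l) (T := greenFamily X k) (green_anti h)) 𝔛

/-- The primary obstruction of a `(k-1)`-split supermanifold: its image under
`Ȟ¹(X, 𝒢^{(k)}) → H¹(X, 𝒬^{(k)})`. -/
def SplitSupermanifold.obstruction {k : ℕ} (hk : 2 ≤ k) (𝔛 : X.SplitSupermanifold k) :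
    Cech.H1 (Cech.grp (X.Q k hk)) :=
  Cech.H1.map (X.greenPair k hk).toSheaf 𝔛

end Supergeometry

namespace SuperEmbedding

open Supergeometry

variable {Y X : Supergeometry.{u}} (f : SuperEmbedding Y X) (k : ℕ) (hk : 2 ≤ k)

/-- The set `Ȟ¹(X, 𝒢^{(k)}_{T*_{Y,-}; T*_{X,-}})` of `(k-1)`-split embeddings over `f`. -/
def Embedding (k : ℕ) : Type u := Cech.H1 (f.relGreen k).presheaf

/-- The pair `𝒢^{(k+1)}_{T*_{Y,-}; T*_{X,-}} ⊆ 𝒢^{(k)}_{T*_{Y,-}; T*_{X,-}}`, `k ≥ 2`. -/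
def relPair : AutPair X where
  S := f.relGreen k
  N := f.relGreen (k + 1)
  le U := inf_le_inf_right _ (green_anti (Nat.le_succ k) U)
  comm hα hβ := ⟨green_commutator hk hα.1 hβ.1,
    (f.relAut _).mul_mem ((f.relAut _).mul_mem ((f.relAut _).mul_mem hα.2 hβ.2)
      ((f.relAut _).inv_mem hα.2)) ((f.relAut _).inv_mem hβ.2)⟩

/-- The `k`-th obstruction sheaf `𝒬^{(k)}_{T*_{Y,-}; T*_{X,-}}` of the embedding. -/
abbrev relQ : TopCat.Sheaf AddCommGrpCat.{u} X.space := (f.relPair k hk).sheaf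

/-- The inclusion `𝒬^{(k)}_{T*_{Y,-}; T*_{X,-}} → 𝒬^{(k)}_{T*_{X,-}}`. -/
def relQι : f.relQ k hk ⟶ X.Q k hk :=
  (presheafToSheaf (Opens.grothendieckTopology X.space) AddCommGrpCat.{u}).map
    (AutPair.quotPresheafMap (P := f.relPair k hk) (P' := X.greenPair k hk)
      (fun _ => inf_le_left) (fun _ => inf_le_left))

instance : Mono (f.relQι k hk) := by
  have h : Mono (AutPair.quotPresheafMap (P := f.relPair k hk) (P' := X.greenPair k hk)
      (fun _ => inf_le_left) (fun _ => inf_le_left)) := by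
    refine (NatTrans.mono_iff_mono_app _).mpr fun U => ?_
    refine (AddCommGrpCat.mono_iff_injective _).mpr ?_
    refine (injective_iff_map_eq_zero (AutPair.quotMap (P := f.relPair k hk)
      (P' := X.greenPair k hk) (fun _ => inf_le_left) (fun _ => inf_le_left)
      U.unop).toAdditive).mpr fun a ha => ?_
    obtain ⟨α, hα⟩ := QuotientGroup.mk_surjective (s := (f.relPair k hk).sub U.unop) a.toMul
    obtain rfl : Additive.ofMul _ = a := hα
    have h1 := (QuotientGroup.eq_one_iff (N := (X.greenPair k hk).sub U.unop) _).mp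
      (congrArg Additive.toMul ha)
    exact congrArg Additive.ofMul ((QuotientGroup.eq_one_iff (N := (f.relPair k hk).sub U.unop)
      α).mpr (Subgroup.mem_subgroupOf.mpr ⟨Subgroup.mem_subgroupOf.mp h1, α.2.2⟩))
  have h' : PreservesFiniteLimits (presheafToSheaf (Opens.grothendieckTopology X.space)
    AddCommGrpCat.{u}) := inferInstance
  have h'' := preservesMonomorphisms_of_preservesLimitsOfShape
    (presheafToSheaf (Opens.grothendieckTopology X.space) AddCommGrpCat.{u})
  exact @Functor.map_mono _ _ _ _ (presheafToSheaf (Opens.grothendieckTopology X.space)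
    AddCommGrpCat.{u}) h'' _ _ _ h

/-- The sheaf `ℛ^{(k)} = 𝒬^{(k)}_{T*_{X,-}} / 𝒬^{(k)}_{T*_{Y,-}; T*_{X,-}}`. -/
abbrev R : TopCat.Sheaf AddCommGrpCat.{u} X.space := cokernel (f.relQι k hk)

/-- The sequence `0 → 𝒬^{(k)}_{T*_{Y,-}; T*_{X,-}} → 𝒬^{(k)}_{T*_{X,-}} → ℛ^{(k)} → 0`. -/
def ambientSeq : ShortComplex (TopCat.Sheaf AddCommGrpCat.{u} X.space) :=
  ShortComplex.mk (f.relQι k hk) (cokernel.π _) (cokernel.condition _)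

theorem ambientSeq_shortExact : (f.ambientSeq k hk).ShortExact where
  exact := ShortComplex.exact_cokernel _
  mono_f := inferInstanceAs (Mono (f.relQι k hk))
  epi_g := inferInstanceAs (Epi (cokernel.π (f.relQι k hk)))

/-- The functor `F ↦ F|_Y` (inverse image along `i`). -/
abbrev restr : TopCat.Sheaf AddCommGrpCat.{u} X.space ⥤ TopCat.Sheaf AddCommGrpCat.{u} Y.space :=
  TopCat.Sheaf.pullback AddCommGrpCat.{u} f.base

instance : PreservesFiniteLimits f.restr := by
  unfold restr TopCat.Sheaf.pullback
  apply Functor.sheafPullbackConstruction.preservesFiniteLimits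

/-- The restriction `r` as a map of quotient groups. -/
def quotRes (U : Opens X.space) :
    (f.relPair k hk).Quot U →* (Y.greenPair k hk).Quot (f.pre U) :=
  QuotientGroup.map ((f.relPair k hk).sub U) ((Y.greenPair k hk).sub (f.pre U)) (f.greenRes k U)
    (fun α hα => Subgroup.mem_comap.mpr (Subgroup.mem_subgroupOf.mpr
      (f.relRes_mem ⟨α.1, α.2.2⟩ (Subgroup.mem_subgroupOf.mp hα).1)))

/-- The restriction `r` as a morphism of presheaves of quotients. -/
def quotResHom : (f.relPair k hk).quotPresheaf ⟶
    (Opens.map f.base).op ⋙ (Y.greenPair k hk).quotPresheaf where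
  app U := AddCommGrpCat.ofHom (X := Additive ((f.relPair k hk).Quot U.unop))
    (Y := Additive ((Y.greenPair k hk).Quot (f.pre U.unop))) (f.quotRes k hk U.unop).toAdditive
  naturality U V h := by
    refine AddCommGrpCat.hom_ext (AddMonoidHom.ext fun a => ?_)
    obtain ⟨α, hα⟩ := QuotientGroup.mk_surjective (s := (f.relPair k hk).sub U.unop) a.toMul
    obtain rfl : Additive.ofMul _ = a := hα
    exact congrArg (fun β => Additive.ofMul ((Y.greenPair k hk).proj (f.pre V.unop) β))
      (Subtype.ext (f.greenRes_res k (leOfHom h.unop) α).symm)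

/-- The morphism `𝒬^{(k)}_{T*_{Y,-}; T*_{X,-}} → i_* 𝒬^{(k)}_{T*_{Y,-}}` induced by `r`. -/
def relQToPush : f.relQ k hk ⟶ (TopCat.Sheaf.pushforward AddCommGrpCat.{u} f.base).obj (Y.Q k hk) :=
  ⟨sheafifyLift (Opens.grothendieckTopology X.space) (f.quotResHom k hk ≫
    Functor.whiskerLeft (Opens.map f.base).op
      (toSheafify (Opens.grothendieckTopology Y.space) (Y.greenPair k hk).quotPresheaf))
    ((TopCat.Sheaf.pushforward AddCommGrpCat.{u} f.base).obj (Y.Q k hk)).property⟩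

/-- The morphism `𝒬^{(k)}_{T*_{Y,-}; T*_{X,-}}|_Y → 𝒬^{(k)}_{T*_{Y,-}}` induced by `r`. -/
def relQRes : f.restr.obj (f.relQ k hk) ⟶ Y.Q k hk :=
  ((TopCat.Sheaf.pullbackPushforwardAdjunction AddCommGrpCat.{u} f.base).homEquiv _ _).symm
    (f.relQToPush k hk)

/-- The middle term of the lower sequence: the sheaf `𝒬^{(k)}_{T*_{X,-}}|_Y` modulo the kernel of
`r : 𝒬^{(k)}_{T*_{Y,-}; T*_{X,-}}|_Y → 𝒬^{(k)}_{T*_{Y,-}}`, as the pushout of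
`𝒬^{(k)}_{T*_{Y,-}} ← 𝒬^{(k)}_{T*_{Y,-}; T*_{X,-}}|_Y → 𝒬^{(k)}_{T*_{X,-}}|_Y` (`r` is surjective). -/
abbrev midQ : TopCat.Sheaf AddCommGrpCat.{u} Y.space :=
  pushout (f.relQRes k hk) (f.restr.map (f.relQι k hk))

/-- The projection `midQ → ℛ^{(k)}|_Y`. -/
def midQToR : f.midQ k hk ⟶ f.restr.obj (f.R k hk) :=
  pushout.desc 0 (f.restr.map (cokernel.π (f.relQι k hk))) (by
    rw [comp_zero, ← f.restr.map_comp, cokernel.condition, Functor.map_zero])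

/-- The sequence `0 → 𝒬^{(k)}_{T*_{Y,-}} → midQ → ℛ^{(k)}|_Y → 0`. -/
def embeddedSeq : ShortComplex (TopCat.Sheaf AddCommGrpCat.{u} Y.space) :=
  ShortComplex.mk (pushout.inl (f.relQRes k hk) (f.restr.map (f.relQι k hk))) (f.midQToR k hk)
    (pushout.inl_desc _ _ _)

theorem embeddedSeq_shortExact : (f.embeddedSeq k hk).ShortExact := by
  have hm : Mono (f.restr.map (f.relQι k hk)) := Functor.map_mono _ _
  have he : Epi (f.restr.map (cokernel.π (f.relQι k hk))) := Functor.map_epi _ _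
  have hw : f.restr.map (f.relQι k hk) ≫ f.restr.map (cokernel.π (f.relQι k hk)) = 0 := by
    rw [← f.restr.map_comp, cokernel.condition, Functor.map_zero]
  exact pushout_shortExact _ _ _ hw
    (CokernelCofork.mapIsColimit _ (cokernelIsCokernel (f.relQι k hk)) f.restr)

/-- The restriction `H⁰(X, F) → H⁰(Y, F|_Y)`. -/
def H0res (F : TopCat.Sheaf AddCommGrpCat.{u} X.space) : Cech.H0 F →+ Cech.H0 (f.restr.obj F) :=
  Cech.smap ((TopCat.Sheaf.pullbackPushforwardAdjunction AddCommGrpCat.{u} f.base).unit.app F) ⊤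

/-- The restriction of sections `r_* : H⁰(X, ℛ^{(k)}) → H⁰(Y, ℛ^{(k)}|_Y)`. -/
def resR : Cech.H0 (f.R k hk) →+ Cech.H0 (f.restr.obj (f.R k hk)) := f.H0res (f.R k hk)

/-- The connecting map `δ₁ : H⁰(X, ℛ^{(k)}) → H¹(X, 𝒬^{(k)}_{T*_{Y,-}; T*_{X,-}})` of the sequence
`0 → 𝒬^{(k)}_{T*_{Y,-}; T*_{X,-}} → 𝒬^{(k)}_{T*_{X,-}} → ℛ^{(k)} → 0`. -/
def δ₁ : Cech.H0 (f.R k hk) → Cech.H1 (Cech.grp (f.relQ k hk)) :=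
  Cech.delta (f.ambientSeq k hk) (f.ambientSeq_shortExact k hk)

/-- The connecting map `δ₂ : H⁰(Y, ℛ^{(k)}|_Y) → H¹(Y, 𝒬^{(k)}_{T*_{Y,-}})` of the sequence
`0 → 𝒬^{(k)}_{T*_{Y,-}} → midQ → ℛ^{(k)}|_Y → 0`. -/
def δ₂ : Cech.H0 (f.restr.obj (f.R k hk)) → Cech.H1 (Cech.grp (Y.Q k hk)) :=
  Cech.delta (f.embeddedSeq k hk) (f.embeddedSeq_shortExact k hk)

/-- `r_* : Ȟ¹(X, 𝒢^{(k)}_{T*_{Y,-}; T*_{X,-}}) → Ȟ¹(Y, 𝒢^{(k)}_{T*_{Y,-}})`. -/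
def rStar (k : ℕ) (Z : f.Embedding k) : Y.SplitSupermanifold k :=
  Cech.H1.pull f.base (f.greenResHom k) Z

/-- `u_* : Ȟ¹(X, 𝒢^{(k)}_{T*_{Y,-}; T*_{X,-}}) → Ȟ¹(X, 𝒢^{(k)}_{T*_{X,-}})`. -/
def uStar (k : ℕ) (Z : f.Embedding k) : X.SplitSupermanifold k :=
  Cech.H1.map (AutFamily.incl (S := f.relGreen k) (T := greenFamily X k) fun _ => inf_le_left) Z

/-- `Z` is an embedding `𝔜 ⊂ 𝔛` over `f`, of total splitting type `(k; k', k'')`: `𝔜` and `𝔛`,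
seen as `(k-1)`-split supermanifolds, are `r_* Z` and `u_* Z`. -/
def HasTotalSplittingType (k k' k'' : ℕ) (Z : f.Embedding k) (𝔜 : Y.SplitSupermanifold k')
    (𝔛 : X.SplitSupermanifold k'') : Prop :=
  ∃ (h' : k ≤ k') (h'' : k ≤ k''), f.rStar k Z = 𝔜.coarsen h' ∧ f.uStar k Z = 𝔛.coarsen h''

/-- The primary obstruction of a `(k-1)`-split embedding: its image under
`Ȟ¹(X, 𝒢^{(k)}_{T*_{Y,-}; T*_{X,-}}) → H¹(X, 𝒬^{(k)}_{T*_{Y,-}; T*_{X,-}})`. -/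
def obstruction (Z : f.Embedding k) : Cech.H1 (Cech.grp (f.relQ k hk)) :=
  Cech.H1.map (f.relPair k hk).toSheaf Z

end SuperEmbedding

end

/-!
The embedding `Z` has an ambient supermanifold `u_* Z` which is the image of a `k`-split one, so
that the structure group of `u_* Z` reduces to `𝒢^{(k+1)}`, which dies in
`𝒬^{(k)} = 𝒢^{(k)} / 𝒢^{(k+1)}`. Hence `ω(u_* Z)`, which is the image of `ω(Z)` under
`H¹(X, 𝒬^{(k)}_{T*_{Y,-}; T*_{X,-}}) → H¹(X, 𝒬^{(k)}_{T*_{X,-}})`, is trivial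
(`Supergeometry.SplitSupermanifold.obstruction_coarsen_isTrivial`,
`SuperEmbedding.map_relQι_obstruction`), and exactness of the long cohomology sequence
(`Cech.exists_isConnecting_of_isTrivial`) gives a section `φ` of `ℛ^{(k)}` with `δ₁ φ = ω(Z)`.

The restriction `r` and the units `F ⟶ i_* (F|_Y)` form a morphism from the exact sequence on `X` to
the direct image of the exact sequence on `Y` (`SuperEmbedding.seqHom`). Connecting maps are natural
for such morphisms (`Cech.IsConnecting.pull`), whence `δ₂ (r_* φ) = r_* (δ₁ φ) = r_* ω(Z)`. As `r` is
compatible with passing to the obstruction sheaves (`SuperEmbedding.pull_relQToPush_obstruction`),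
this class is `ω(r_* Z) = ω(𝔜)`.
-/

namespace Cech

variable {X : TopCat.{u}}

/-- A class in `Ȟ¹(X, G)` is trivial if it is represented by a cocycle all of whose values
are `1`. -/
def H1.IsTrivial {G : (Opens X)ᵒᵖ ⥤ GrpCat.{u}} (c : H1 G) : Prop :=
  ∃ g : Cocycle G, (∀ x y, g.val x y = 1) ∧ c = Quotient.mk _ g

theorem H1.map_isTrivial {G G' : (Opens X)ᵒᵖ ⥤ GrpCat.{u}} (φ : G ⟶ G')
    (hφ : ∀ U (s : G.obj U), φ.app U s = 1) (c : H1 G) : (H1.map φ c).IsTrivial := by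
  obtain ⟨g, rfl⟩ := Quotient.exists_rep c
  exact ⟨g.map φ, fun x y => hφ _ _, rfl⟩

theorem H1.map_map {G G' G'' : (Opens X)ᵒᵖ ⥤ GrpCat.{u}} (φ : G ⟶ G') (ψ : G' ⟶ G'') (c : H1 G) :
    H1.map ψ (H1.map φ c) = H1.map (φ ≫ ψ) c := by
  obtain ⟨g, rfl⟩ := Quotient.exists_rep c
  rfl

theorem H1.map_id {G : (Opens X)ᵒᵖ ⥤ GrpCat.{u}} (c : H1 G) : H1.map (𝟙 G) c = c := by
  obtain ⟨g, rfl⟩ := Quotient.exists_rep c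
  rfl

theorem H1.pull_map {Y : TopCat.{u}} (f : Y ⟶ X) {G G' : (Opens X)ᵒᵖ ⥤ GrpCat.{u}}
    {K : (Opens Y)ᵒᵖ ⥤ GrpCat.{u}} (φ : G ⟶ G') (ψ : G' ⟶ (Opens.map f).op ⋙ K) (c : H1 G) :
    H1.pull f ψ (H1.map φ c) = H1.pull f (φ ≫ ψ) c := by
  obtain ⟨g, rfl⟩ := Quotient.exists_rep c
  rfl

theorem H1.map_pull {Y : TopCat.{u}} (f : Y ⟶ X) {G : (Opens X)ᵒᵖ ⥤ GrpCat.{u}}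
    {K K' : (Opens Y)ᵒᵖ ⥤ GrpCat.{u}} (φ : G ⟶ (Opens.map f).op ⋙ K) (ψ : K ⟶ K') (c : H1 G) :
    H1.map ψ (H1.pull f φ c) = H1.pull f (φ ≫ Functor.whiskerLeft (Opens.map f).op ψ) c := by
  obtain ⟨g, rfl⟩ := Quotient.exists_rep c
  rfl

/-- Compatible sections over the members of a covering glue to a global section. -/
theorem exists_glue (A : TopCat.Sheaf AddCommGrpCat.{u} X) (𝒰 : Cover X)
    (s : ∀ x, sec A (𝒰.set x))
    (h : ∀ x y, sres A (inf_le_left : 𝒰.set x ⊓ 𝒰.set y ≤ _) (s x) = sres A inf_le_right (s y)) :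
    ∃ t : H0 A, ∀ x, sres A le_top t = s x := by
  obtain ⟨t, ht, -⟩ := A.existsUnique_gluing' 𝒰.set ⊤ (fun x => homOfLE le_top)
    (fun x _ => Opens.mem_iSup.mpr ⟨x, 𝒰.mem x⟩) s h
  exact ⟨t, ht⟩

theorem smap_smap_eq_zero (S : ShortComplex (TopCat.Sheaf AddCommGrpCat.{u} X)) {U : Opens X}
    (a : sec S.X₁ U) : smap S.g U (smap S.f U a) = 0 := by
  have h : S.f.hom.app (op U) ≫ S.g.hom.app (op U) = 0 :=
    congrArg (fun φ : S.X₁ ⟶ S.X₃ => φ.hom.app (op U)) S.zero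
  exact congrArg (fun φ : S.X₁.presheaf.obj (op U) ⟶ S.X₃.presheaf.obj (op U) => φ.hom a) h

/-- The restriction of a cocycle to a finer covering. -/
def Cocycle.refine {G : (Opens X)ᵒᵖ ⥤ GrpCat.{u}} (g : Cocycle G) (𝒲 : Cover X)
    (h : ∀ x, 𝒲.set x ≤ g.cover.set x) : Cocycle G where
  cover := 𝒲
  val x y := res G (inf_le_inf (h x) (h y)) (g.val x y)
  mul_eq x y z := by
    have := congrArg (res G (inf_le_inf (inf_le_inf (h x) (h y)) (h z))) (g.mul_eq x y z)
    simpa using this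

theorem Cocycle.refine_cohomologous {G : (Opens X)ᵒᵖ ⥤ GrpCat.{u}} (g : Cocycle G) (𝒲 : Cover X)
    (h : ∀ x, 𝒲.set x ≤ g.cover.set x) : g.Cohomologous (g.refine 𝒲 h) :=
  ⟨𝒲, h, fun _ => le_rfl, fun _ => 1, fun x y => by
    simp only [map_one, one_mul, inv_one, mul_one]
    exact res_res G _ _ _⟩

/-- Exactness of `H⁰(X, C) → H¹(X, A) → H¹(X, B)` at `H¹(X, A)`: a trivialisation `b_x` of the
image in `B` of a cocycle `a_{xy}` satisfies `a_{xy} = b_y - b_x`, so that the images of the `b_x`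
in `C` glue. -/
theorem exists_isConnecting_of_isTrivial (S : ShortComplex (TopCat.Sheaf AddCommGrpCat.{u} X))
    (c : H1 (grp S.X₁)) (hc : (H1.map (grpMap S.f) c).IsTrivial) :
    ∃ s, IsConnecting S s c := by
  obtain ⟨a, rfl⟩ := Quotient.exists_rep c
  obtain ⟨g, hg, e⟩ := hc
  -- `b` is the `0`-cochain on the common refinement `𝒲` with `1 = b_x a_{xy} b_y⁻¹` in `B`.
  obtain ⟨𝒲, h, h', b, hb⟩ := Quotient.exact e
  have key : ∀ x y, smap S.f _ (sres S.X₁ (inf_le_inf (h x) (h y)) (a.val x y).toAdd) =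
      sres S.X₂ inf_le_right (Multiplicative.toAdd (b y)) -
        sres S.X₂ (inf_le_left : 𝒲.set x ⊓ 𝒲.set y ≤ _) (Multiplicative.toAdd (b x)) := by
    intro x y
    have hxy := hb x y
    rw [hg, map_one] at hxy
    have h0 : (0 : sec S.X₂ (𝒲.set x ⊓ 𝒲.set y)) =
        sres S.X₂ inf_le_left (Multiplicative.toAdd (b x)) +
          sres S.X₂ (inf_le_inf (h x) (h y)) (smap S.f _ (a.val x y).toAdd) +
            -sres S.X₂ inf_le_right (Multiplicative.toAdd (b y)) := hxy
    rw [← sub_eq_add_neg, eq_comm, sub_eq_zero] at h0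
    exact (smap_sres S.f _ _).trans (eq_sub_of_add_eq' h0)
  obtain ⟨s, hs⟩ := exists_glue S.X₃ 𝒲 (fun x => smap S.g _ (Multiplicative.toAdd (b x)))
    (fun x y => by
      have := congrArg (smap S.g _) (key x y)
      rw [smap_smap_eq_zero, map_sub, smap_sres, smap_sres] at this
      exact (sub_eq_zero.mp this.symm).symm)
  exact ⟨s, a.refine 𝒲 h, fun x => Multiplicative.toAdd (b x), fun x => (hs x).symm, key,
    Quotient.sound (a.refine_cohomologous 𝒲 h)⟩

theorem IsConnecting.delta_eq {S : ShortComplex (TopCat.Sheaf AddCommGrpCat.{u} X)}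
    (hS : S.ShortExact) {s : H0 S.X₃} {c : H1 (grp S.X₁)} (hc : IsConnecting S s c) :
    delta S hS s = c :=
  IsConnecting.unique hS (exists_isConnecting S hS s).choose_spec hc

/-- A morphism `A ⟶ f_* B` of sheaves of abelian groups, as a morphism of the underlying
presheaves of groups. -/
abbrev grpPushMap {Y : TopCat.{u}} (f : Y ⟶ X) {A : TopCat.Sheaf AddCommGrpCat.{u} X}
    {B : TopCat.Sheaf AddCommGrpCat.{u} Y}
    (φ : A ⟶ (TopCat.Sheaf.pushforward AddCommGrpCat.{u} f).obj B) :
    grp A ⟶ (Opens.map f).op ⋙ grp B :=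
  grpMap φ

/-- The connecting map is natural for morphisms from a short exact sequence on `X` to the direct
image of a short exact sequence on `Y`. -/
theorem IsConnecting.pull {Y : TopCat.{u}} (f : Y ⟶ X)
    {S : ShortComplex (TopCat.Sheaf AddCommGrpCat.{u} X)}
    {T : ShortComplex (TopCat.Sheaf AddCommGrpCat.{u} Y)}
    (φ : S ⟶ T.map (TopCat.Sheaf.pushforward AddCommGrpCat.{u} f))
    {s : H0 S.X₃} {c : H1 (grp S.X₁)} (hc : IsConnecting S s c) :
    IsConnecting T (smap φ.τ₃ ⊤ s) (H1.pull f (grpPushMap f φ.τ₁) c) := by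
  obtain ⟨a, b, hb, hab, rfl⟩ := hc
  have h₁₂ : ∀ U (t : sec S.X₁ U), smap (T.map (TopCat.Sheaf.pushforward AddCommGrpCat.{u} f)).f U
      (smap φ.τ₁ U t) = smap φ.τ₂ U (smap S.f U t) := fun U t =>
    congrArg (fun α => smap α U t) φ.comm₁₂
  have h₂₃ : ∀ U (t : sec S.X₂ U), smap (T.map (TopCat.Sheaf.pushforward AddCommGrpCat.{u} f)).g U
      (smap φ.τ₂ U t) = smap φ.τ₃ U (smap S.g U t) := fun U t =>
    congrArg (fun α => smap α U t) φ.comm₂₃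
  refine ⟨a.pull f (grpPushMap f φ.τ₁), fun y => smap φ.τ₂ _ (b (f y)), fun y => ?_,
    fun x y => ?_, rfl⟩
  · have h := h₂₃ _ (b (f y))
    rw [hb, smap_sres] at h
    exact h
  · have h := (h₁₂ _ _).trans (congrArg (smap φ.τ₂ _) (hab (f x) (f y)))
    rw [map_sub, smap_sres, smap_sres] at h
    exact h

end Cech

/-- A commutative square out of `L.obj A` transposes along `L ⊣ R`. -/
theorem transpose_square {C D : Type*} [Category C] [Category D] {L : C ⥤ D} {R : D ⥤ C}
    (adj : L ⊣ R) {A B : C} {A' P : D} {ρ : A ⟶ R.obj A'} {i : A ⟶ B} {a : A' ⟶ P}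
    {b : L.obj B ⟶ P} (w : (adj.homEquiv _ _).symm ρ ≫ a = L.map i ≫ b) :
    ρ ≫ R.map a = i ≫ adj.unit.app B ≫ R.map b := by
  have := congrArg (adj.homEquiv _ _) w
  rwa [adj.homEquiv_naturality_right, adj.homEquiv_naturality_left, Equiv.apply_symm_apply,
    adj.homEquiv_unit] at this

/-- A factorisation of `L.map q` transposes along `L ⊣ R`. -/
theorem transpose_factorisation {C D : Type*} [Category C] [Category D] {L : C ⥤ D} {R : D ⥤ C}
    (adj : L ⊣ R) {B Q : C} {P : D} {q : B ⟶ Q} {b : L.obj B ⟶ P} {m : P ⟶ L.obj Q}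
    (w : b ≫ m = L.map q) :
    (adj.unit.app B ≫ R.map b) ≫ R.map m = q ≫ adj.unit.app Q := by
  rw [Category.assoc, ← R.map_comp, w]
  exact adj.unit_naturality q

namespace SuperEmbedding

open Supergeometry

variable {Y X : Supergeometry.{u}} (f : SuperEmbedding Y X) (k : ℕ) (hk : 2 ≤ k)

/-- The morphism from the sequence
`0 → 𝒬^{(k)}_{T*_{Y,-}; T*_{X,-}} → 𝒬^{(k)}_{T*_{X,-}} → ℛ^{(k)} → 0` on `X` to the direct image of
the sequence `0 → 𝒬^{(k)}_{T*_{Y,-}} → midQ → ℛ^{(k)}|_Y → 0` on `Y`: the first component is induced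
by `r`, the others come from the units `F ⟶ i_* (F|_Y)`. -/
noncomputable def seqHom : f.ambientSeq k hk ⟶
    (f.embeddedSeq k hk).map (TopCat.Sheaf.pushforward AddCommGrpCat.{u} f.base) where
  τ₁ := f.relQToPush k hk
  τ₂ := (TopCat.Sheaf.pullbackPushforwardAdjunction AddCommGrpCat.{u} f.base).unit.app (X.Q k hk) ≫
    (TopCat.Sheaf.pushforward AddCommGrpCat.{u} f.base).map
      (pushout.inr (f.relQRes k hk) (f.restr.map (f.relQι k hk)))
  τ₃ := (TopCat.Sheaf.pullbackPushforwardAdjunction AddCommGrpCat.{u} f.base).unit.app (f.R k hk)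
  comm₁₂ := transpose_square (TopCat.Sheaf.pullbackPushforwardAdjunction AddCommGrpCat.{u} f.base)
    pushout.condition
  comm₂₃ := transpose_factorisation
    (TopCat.Sheaf.pullbackPushforwardAdjunction AddCommGrpCat.{u} f.base) (pushout.inr_desc _ _ _)

/-- The inclusion of obstruction sheaves is compatible with the projections from the sheaves of
automorphisms. -/
theorem toSheaf_relQι : (f.relPair k hk).toSheaf ≫ Cech.grpMap (f.relQι k hk) =
    AutFamily.incl (S := f.relGreen k) (T := greenFamily X k) (fun _ => inf_le_left) ≫
      (X.greenPair k hk).toSheaf := by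
  have h := toSheafify_naturality (Opens.grothendieckTopology X.space)
    (AutPair.quotPresheafMap (P := f.relPair k hk) (P' := X.greenPair k hk)
      (fun _ => inf_le_left) (fun _ => inf_le_left))
  refine NatTrans.ext (funext fun U => GrpCat.hom_ext (MonoidHom.ext fun α => ?_))
  exact (congrArg (fun φ : (f.relPair k hk).quotPresheaf ⟶ _ =>
    (φ.app U).hom (Additive.ofMul ((f.relPair k hk).proj U.unop α))) h).symm

/-- The map of obstruction sheaves induced by `r` is compatible with `r` and the projections from
the sheaves of automorphisms. -/
theorem toSheaf_relQToPush :
    (f.relPair k hk).toSheaf ≫ Cech.grpPushMap f.base (f.relQToPush k hk) =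
      f.greenResHom k ≫ Functor.whiskerLeft (Opens.map f.base).op (Y.greenPair k hk).toSheaf := by
  have h := toSheafify_sheafifyLift (Opens.grothendieckTopology X.space) (f.quotResHom k hk ≫
    Functor.whiskerLeft (Opens.map f.base).op
      (toSheafify (Opens.grothendieckTopology Y.space) (Y.greenPair k hk).quotPresheaf))
    ((TopCat.Sheaf.pushforward AddCommGrpCat.{u} f.base).obj (Y.Q k hk)).property
  refine NatTrans.ext (funext fun U => GrpCat.hom_ext (MonoidHom.ext fun α => ?_))
  exact congrArg (fun φ : (f.relPair k hk).quotPresheaf ⟶ _ =>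
    (φ.app U).hom (Additive.ofMul ((f.relPair k hk).proj U.unop α))) h

/-- The inclusion of obstruction sheaves takes `ω(Z)` to `ω(u_* Z)`. -/
theorem map_relQι_obstruction (Z : f.Embedding k) :
    Cech.H1.map (Cech.grpMap (f.relQι k hk)) (f.obstruction k hk Z) =
      (f.uStar k Z).obstruction hk := by
  refine (Cech.H1.map_map (f.relPair k hk).toSheaf _ Z).trans ?_
  rw [toSheaf_relQι]
  exact (Cech.H1.map_map _ (X.greenPair k hk).toSheaf Z).symm

/-- The map of obstruction sheaves induced by `r` takes `ω(Z)` to `ω(r_* Z)`. -/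
theorem pull_relQToPush_obstruction (Z : f.Embedding k) :
    Cech.H1.pull f.base (Cech.grpPushMap f.base (f.relQToPush k hk)) (f.obstruction k hk Z) =
      (f.rStar k Z).obstruction hk := by
  refine (Cech.H1.pull_map f.base (f.relPair k hk).toSheaf _ Z).trans ?_
  rw [toSheaf_relQToPush]
  exact (Cech.H1.map_pull f.base (f.greenResHom k) (Y.greenPair k hk).toSheaf Z).symm

end SuperEmbedding

namespace Supergeometry

variable {X : Supergeometry.{u}}

theorem AutPair.toSheafHom_eq_one (P : AutPair X) {U : Opens X.space} (α : P.S.grp U)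
    (hα : α.1 ∈ P.N.grp U) : P.toSheafHom U α = 1 := by
  have h : P.proj U α = 1 :=
    (QuotientGroup.eq_one_iff (N := P.sub U) α).mpr (Subgroup.mem_subgroupOf.mpr hα)
  change Multiplicative.ofAdd (((toSheafify (Opens.grothendieckTopology X.space)
    P.quotPresheaf).app (op U)).hom (Additive.ofMul (P.proj U α))) = 1
  rw [h]
  exact map_zero ((toSheafify (Opens.grothendieckTopology X.space) P.quotPresheaf).app (op U)).hom

/-- In a pair `N ⊆ S`, the elements of `Ȟ¹(X, N)` have trivial image in `H¹(X, S / N)`. -/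
theorem AutPair.map_toSheaf_isTrivial (P : AutPair X) (c : Cech.H1 P.N.presheaf) :
    (Cech.H1.map P.toSheaf (Cech.H1.map (AutFamily.incl P.le) c)).IsTrivial := by
  rw [Cech.H1.map_map]
  refine Cech.H1.map_isTrivial _ (fun U α => ?_) c
  have h (β : P.N.grp U.unop) : P.toSheafHom U.unop (Subgroup.inclusion (P.le U.unop) β) = 1 :=
    P.toSheafHom_eq_one _ β.2
  exact h α

/-- The primary obstruction of a `(k-1)`-split supermanifold vanishes if it is `k`-split:
`𝒢^{(k+1)}` maps to zero in `𝒬^{(k)} = 𝒢^{(k)} / 𝒢^{(k+1)}`. -/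
theorem SplitSupermanifold.obstruction_coarsen_isTrivial {k : ℕ} (hk : 2 ≤ k)
    (𝔛 : X.SplitSupermanifold (k + 1)) :
    ((𝔛.coarsen (Nat.le_succ k)).obstruction hk).IsTrivial :=
  (X.greenPair k hk).map_toSheaf_isTrivial 𝔛

theorem SplitSupermanifold.coarsen_self {k : ℕ} (h : k ≤ k) (𝔛 : X.SplitSupermanifold k) :
    𝔛.coarsen h = 𝔛 :=
  Cech.H1.map_id 𝔛

end Supergeometry

theorem mainTheorem2 {Y X : Supergeometry.{u}} (f : SuperEmbedding Y X) (k : ℕ) (hk : 2 ≤ k)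
    (Z : f.Embedding k) (𝔜 : Y.SplitSupermanifold k) (𝔛 : X.SplitSupermanifold (k + 1))
    (h : f.HasTotalSplittingType k k (k + 1) Z 𝔜 𝔛) :
    ∃ φ : Cech.H0 (f.R k hk),
      f.δ₁ k hk φ = f.obstruction k hk Z ∧
        f.δ₂ k hk (f.resR k hk φ) = 𝔜.obstruction hk := by
  obtain ⟨h', h'', hY, hX⟩ := h
  rw [Supergeometry.SplitSupermanifold.coarsen_self] at hY
  have htriv : (Cech.H1.map (Cech.grpMap (f.relQι k hk)) (f.obstruction k hk Z)).IsTrivial := by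
    rw [f.map_relQι_obstruction, hX]
    exact 𝔛.obstruction_coarsen_isTrivial hk
  obtain ⟨φ, hφ⟩ := Cech.exists_isConnecting_of_isTrivial (f.ambientSeq k hk) _ htriv
  refine ⟨φ, hφ.delta_eq (f.ambientSeq_shortExact k hk), ?_⟩
  -- By naturality the section `r_* φ` has image `r_* ω(Z)` under `δ₂`, and this is `ω(r_* Z) = ω(𝔜)`.
  have hφ' := (hφ.pull f.base (f.seqHom k hk)).delta_eq (f.embeddedSeq_shortExact k hk)
  rw [← hY, ← f.pull_relQToPush_obstruction]
  exact hφ'
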